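/- For each $n\ge 1$ let $p=p_n\ge 2$ and let $X_1,\dots,X_n$ be i.i.d. $N_p(\theta,\Sigma)$ random vectors, where $\theta=\theta_n\in\mathbb{R}^p$ and $\Sigma=\Sigma_n=(\sigma_{ij})$ is a covariance matrix with precision matrix $\Gamma=\Sigma^{-1}=(\gamma_{ij})$. Let $$d=d_n=\max\Big\{1,\ \max_{1\le j\le p}\#\{k\neq j:\gamma_{jk}\neq 0\}\Big\}.$$ Let $\bar X=n^{-1}\sum_{i=1}^n X_i$, let $\widetilde{\mathbf X}$ be the $n\times p$ matrix with rows $(X_i-\bar X)'$, let $\widetilde X_j$ be its $j$th column and $\widetilde{\mathbf X}_{-j}$ the matrix without the $j$th column, and let $\widehat\Sigma=n^{-1}\widetilde{\mathbf X}'\widetilde{\mathbf X}$. For $j=1,\dots,p$ and deterministic tuning parameters $\lambda_j=\lambda_{n,j}>0$ let $$\widehat\gamma_j\in\arg\min_{\gamma\in\mathbb{R}^{p-1}}\Big(|\widetilde X_j-\widetilde{\mathbf X}_{-j}\gamma|_2^2/n+2\lambda_j|\gamma|_1\Big),\qquad \widehat\gamma_j=(\widehat\gamma_{jk})_{k\ne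 j},$$ be any minimizer, and $\widehat\tau_j^2=|\widetilde X_j-\widetilde{\mathbf X}_{-j}\widehat\gamma_j|_2^2/n+\lambda_j|\widehat\gamma_j|_1$. Let $\widehat C$ be the $p\times p$ matrix with $\widehat c_{jj}=1$ and $\widehat c_{jk}=-\widehat\gamma_{jk}$ for $k\ne j$, and let $\widehat\Gamma=\mathrm{diag}(\widehat\tau_1^{2},\dots,\widehat\tau_p^{2})^{-1}\widehat C$ be the nodewise Lasso estimator of $\Gamma$. For all constants $c_1,c_2>0$ there is a constant $A_0=A_0(c_1,c_2)>0$ such that the following holds for every constant $A_1$. Suppose that, for all $n$, $\max_{1\le j\le p}\sigma_{jj}<c_1$ and $\lambda_{\min}(\Sigma)>c_2$, that $d^2\log(p)/n\to 0$ as $n\to\infty$, and that $A_0\sqrt{\log(p)/n}\le\lambda_{j}\le A_1\sqrt{\log(p)/n}$ for all $n$ and $1\le j\le p$. Then, as $n\to\infty$, $$\max_{1\le j\le p}\big|(\widehat\Gamma-\Gamma)_{jj}\big|=O_p\Big(\sqrt{d\log(p)/n}\Big),\qquad \max_{1\le j\le p}\sum_{k=1}^p\big|(\widehat\Gamma-\Gamma)_{jk}\big|=O_p\Big(d\sqrt{\log(p)/n}\Big),$$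 $$\max_{1\le i,j\le p}\big|(\widehat\Gamma\widehat\Sigma\widehat\Gamma'-\widehat\Gamma')_{ij}\big|=O_p\Big(\sqrt{d\log(p)/n}\Big).$$ -/

import Mathlib

open MeasureTheory ProbabilityTheory Filter Topology

noncomputable section

namespace NodewiseLasso

/-- `Z n = O_p(r n)`: for every `ε > 0` there is a constant `M` such that
`P_n(|Z n| > M r n) ≤ ε` for all sufficiently large `n`. The probability spaces may vary with `n`,
and for non-measurable `Z n` the outer measure is meant. -/
def IsBigOP {Ω : ℕ → Type*} [∀ n, MeasurableSpace (Ω n)] (P : ∀ n, Measure (Ω n))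
    (Z : ∀ n, Ω n → ℝ) (r : ℕ → ℝ) : Prop :=
  ∀ ε : ℝ, 0 < ε → ∃ M : ℝ, 0 < M ∧
    ∀ᶠ n in atTop, P n {ω | M * r n < |Z n ω|} ≤ ENNReal.ofReal ε

variable {n p : ℕ}

/-- The largest number of nonzero off-diagonal entries in a row of `G`. -/
def rowSparsity (G : Matrix (Fin p) (Fin p) ℝ) : ℕ :=
  Finset.univ.sup fun j => {k : Fin p | k ≠ j ∧ G j k ≠ 0}.ncard

/-- The sample mean of the rows of an `n × p` data matrix. -/
def sampleMean (x : Matrix (Fin n) (Fin p) ℝ) (j : Fin p) : ℝ :=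
  (∑ i, x i j) / n

/-- The data matrix with its sample mean subtracted from every row. -/
def centered (x : Matrix (Fin n) (Fin p) ℝ) : Matrix (Fin n) (Fin p) ℝ :=
  Matrix.of fun i j => x i j - sampleMean x j

/-- The sample covariance matrix (normalised by `n`). -/
def sampleCov (x : Matrix (Fin n) (Fin p) ℝ) : Matrix (Fin p) (Fin p) ℝ :=
  (n : ℝ)⁻¹ • ((centered x).transpose * centered x)

/-- `|X̃_j - X̃_{-j} γ|² / n`, with `X̃` the centered data. -/
def residualMeanSq (x : Matrix (Fin n) (Fin p) ℝ) (j : Fin p) (γ : {k : Fin p // k ≠ j} → ℝ) : ℝ :=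
  (∑ i, (centered x i j - ∑ k, centered x i k.1 * γ k) ^ 2) / n

/-- `γ` solves the Lasso problem of regressing column `j` of the centered data on the others. -/
def IsLassoSolution (x : Matrix (Fin n) (Fin p) ℝ) (lam : ℝ) (j : Fin p)
    (γ : {k : Fin p // k ≠ j} → ℝ) : Prop :=
  IsMinOn (fun γ' => residualMeanSq x j γ' + 2 * lam * ∑ k, |γ' k|) Set.univ γ

/-- `τ̂_j²`. -/
def tauSq (x : Matrix (Fin n) (Fin p) ℝ) (lam : Fin p → ℝ)
    (γ : ∀ j : Fin p, {k : Fin p // k ≠ j} → ℝ) (j : Fin p) : ℝ :=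
  residualMeanSq x j (γ j) + lam j * ∑ k, |γ j k|

/-- The matrix `Ĉ` with unit diagonal and off-diagonal entries `-γ̂_{ij}`. -/
def coefMatrix (γ : ∀ j : Fin p, {k : Fin p // k ≠ j} → ℝ) : Matrix (Fin p) (Fin p) ℝ :=
  Matrix.of fun i j => if h : j = i then 1 else -γ i ⟨j, h⟩

/-- The nodewise Lasso estimator `Γ̂ = T̂⁻² Ĉ` built from the Lasso coefficients `γ`. -/
def precisionEstimator (x : Matrix (Fin n) (Fin p) ℝ) (lam : Fin p → ℝ)
    (γ : ∀ j : Fin p, {k : Fin p // k ≠ j} → ℝ) : Matrix (Fin p) (Fin p) ℝ :=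
  Matrix.diagonal (fun j => (tauSq x lam γ j)⁻¹) * coefMatrix γ

/-- `max_j |A_jj|`. -/
def maxDiag (A : Matrix (Fin p) (Fin p) ℝ) : ℝ := ⨆ j, |A j j|

/-- `max_j |A_j|_1` over the rows `A_j`. -/
def maxRowL1 (A : Matrix (Fin p) (Fin p) ℝ) : ℝ := ⨆ j, ∑ k, |A j k|

/-- `max_{i,j} |A_ij|`. -/
def maxEntry (A : Matrix (Fin p) (Fin p) ℝ) : ℝ := ⨆ i, ⨆ j, |A i j|

end NodewiseLasso

end

namespace NodewiseLasso

/-! ### Concentration of quadratic forms of Gaussian samples -/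

section GaussianSquares

open scoped NNReal

lemma inv_sqrt_one_sub_two_mul_le_exp {y : ℝ} (hy : |y| ≤ 1 / 4) :
    (√(1 - 2 * y))⁻¹ ≤ Real.exp (y + 2 * y ^ 2) := by
  obtain ⟨h1, h2⟩ := abs_le.mp hy
  have hpos : 0 < 1 - 2 * y := by linarith
  have key : 1 ≤ (1 - 2 * y) * Real.exp (2 * y + 4 * y ^ 2) := by
    rcases le_total 0 y with h | h
    · have hz : 0 ≤ 2 * y + 4 * y ^ 2 := by positivity
      calc (1 : ℝ) ≤ (1 - 2 * y) * (1 + (2 * y + 4 * y ^ 2) + (2 * y + 4 * y ^ 2) ^ 2 / 2) := by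
            have e : (1 - 2 * y) * (1 + (2 * y + 4 * y ^ 2) + (2 * y + 4 * y ^ 2) ^ 2 / 2) - 1
                = y ^ 2 * (2 - 4 * y - 8 * y ^ 2 - 16 * y ^ 3) := by ring
            have h3 : y ^ 2 ≤ 1 / 16 := by nlinarith
            have h4 : y ^ 3 ≤ 1 / 64 := by nlinarith [mul_nonneg h h]
            have : 0 ≤ y ^ 2 * (2 - 4 * y - 8 * y ^ 2 - 16 * y ^ 3) :=
              mul_nonneg (sq_nonneg _) (by linarith)
            linarith
        _ ≤ _ := mul_le_mul_of_nonneg_left (Real.quadratic_le_exp_of_nonneg hz) hpos.le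
    · calc (1 : ℝ) ≤ (1 - 2 * y) * ((2 * y + 4 * y ^ 2) + 1) := by
            have : 0 ≤ y ^ 2 * (-y) := mul_nonneg (sq_nonneg _) (by linarith)
            nlinarith
        _ ≤ _ := mul_le_mul_of_nonneg_left (Real.add_one_le_exp _) hpos.le
  have hsq : Real.exp (y + 2 * y ^ 2) ^ 2 = Real.exp (2 * y + 4 * y ^ 2) := by
    rw [← Real.exp_nat_mul]; congr 1; push_cast; ring
  rw [inv_le_iff_one_le_mul₀' (Real.sqrt_pos.mpr hpos)]
  have hnn : 0 ≤ √(1 - 2 * y) * Real.exp (y + 2 * y ^ 2) := by positivity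
  have : 1 ≤ (√(1 - 2 * y) * Real.exp (y + 2 * y ^ 2)) ^ 2 := by
    rw [mul_pow, hsq, Real.sq_sqrt hpos.le]; exact key
  exact (one_le_sq_iff₀ hnn).mp this

lemma mgf_sq_gaussianReal {v : ℝ≥0} {t : ℝ} (ht : 2 * t * v < 1) :
    mgf (fun x : ℝ => x ^ 2) (gaussianReal 0 v) t = (√(1 - 2 * t * v))⁻¹ := by
  by_cases hv : v = 0
  · simp [hv, mgf]
  have hv0 : (0 : ℝ) < v := by positivity
  have hb : 0 < (1 - 2 * t * v) / (2 * v) := by apply div_pos <;> linarith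
  rw [mgf, integral_gaussianReal_eq_integral_smul hv]
  have : ∀ x : ℝ, gaussianPDFReal 0 v x • Real.exp (t * x ^ 2)
      = (√(2 * Real.pi * v))⁻¹ * Real.exp (-((1 - 2 * t * v) / (2 * v)) * x ^ 2) := by
    intro x
    rw [gaussianPDFReal, smul_eq_mul, mul_assoc, ← Real.exp_add]
    congr 2
    field_simp
    ring
  simp_rw [this]
  rw [integral_const_mul, integral_gaussian, ← Real.sqrt_inv, ← Real.sqrt_inv,
    ← Real.sqrt_mul (by positivity)]
  congr 1
  have : 0 < 1 - 2 * t * v := by linarith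
  field_simp

variable {Ω : Type*} [MeasurableSpace Ω] {P : Measure Ω} {v κ : ℝ≥0}

lemma mgf_sq_le_of_hasLaw_gaussianReal {Z : Ω → ℝ} (hZ : HasLaw Z (gaussianReal 0 v) P) {t : ℝ}
    (ht : |t| * v ≤ 1 / 4) :
    0 < mgf (fun ω => Z ω ^ 2) P t ∧
      mgf (fun ω => Z ω ^ 2) P t ≤ Real.exp (t * v + 2 * (t * v) ^ 2) := by
  have habs : |t * v| ≤ 1 / 4 := by rwa [abs_mul, NNReal.abs_eq]
  have hlt : 2 * t * v < 1 := by linarith [(abs_le.mp habs).2]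
  have e : mgf (fun ω => Z ω ^ 2) P t = (√(1 - 2 * (t * v)))⁻¹ := by
    rw [← mul_assoc, ← mgf_sq_gaussianReal hlt, ← hZ.map_eq, mgf_map hZ.aemeasurable (by fun_prop)]
    rfl
  rw [e]
  exact ⟨inv_pos.mpr (Real.sqrt_pos.mpr (by linarith)), inv_sqrt_one_sub_two_mul_le_exp habs⟩

variable {n : ℕ} {Z : Fin n → Ω → ℝ}

lemma integrable_exp_and_mgf_sum_sq_le (hZ : ∀ i, HasLaw (Z i) (gaussianReal 0 v) P)
    (hind : iIndepFun Z P) {t : ℝ} (ht : |t| * v ≤ 1 / 4) :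
    Integrable (fun ω => Real.exp (t * ∑ i, Z i ω ^ 2)) P ∧
      mgf (fun ω => ∑ i, Z i ω ^ 2) P t ≤ Real.exp (n * (t * v + 2 * (t * v) ^ 2)) := by
  have : IsProbabilityMeasure P := hind.isProbabilityMeasure
  have hm : mgf (fun ω => ∑ i, Z i ω ^ 2) P t = ∏ i, mgf (fun ω => Z i ω ^ 2) P t := by
    have h := (hind.comp (fun _ x => x ^ 2) (fun _ => by fun_prop)).mgf_sum₀ (t := t)
      (fun i => by have := (hZ i).aemeasurable; simp only [Function.comp_def]; fun_prop) Finset.univ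
    rw [← show (∑ i, (fun x : ℝ => x ^ 2) ∘ Z i) = fun ω => ∑ i, Z i ω ^ 2 by
      ext ω; simp, h]
    rfl
  constructor
  · refine mgf_pos_iff.mp ?_
    rw [hm]
    exact Finset.prod_pos fun i _ => (mgf_sq_le_of_hasLaw_gaussianReal (hZ i) ht).1
  · rw [hm, Real.exp_nat_mul]
    calc _ ≤ ∏ _i : Fin n, Real.exp (t * v + 2 * (t * v) ^ 2) :=
          Finset.prod_le_prod (fun i _ => (mgf_sq_le_of_hasLaw_gaussianReal (hZ i) ht).1.le)
            fun i _ => (mgf_sq_le_of_hasLaw_gaussianReal (hZ i) ht).2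
      _ = _ := by simp

lemma measureReal_sum_sq_sub_le (hZ : ∀ i, HasLaw (Z i) (gaussianReal 0 v) P)
    (hind : iIndepFun Z P) (hκ : 0 < κ) (hv : v ≤ κ) {t : ℝ} (ht : 0 < t) (htκ : t ≤ κ) :
    P.real {ω | n * t ≤ |∑ i, Z i ω ^ 2 - n * v|} ≤
      2 * Real.exp (-(n * t ^ 2 / (8 * κ ^ 2))) := by
  have : IsProbabilityMeasure P := hind.isProbabilityMeasure
  have hκ' : (0 : ℝ) < κ := by exact_mod_cast hκ
  have hv' : (v : ℝ) ≤ κ := by exact_mod_cast hv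
  set l : ℝ := t / (4 * κ ^ 2) with hl
  have hlpos : 0 < l := by positivity
  have hlv : l * v ≤ 1 / 4 := by
    calc l * v ≤ l * κ := by gcongr
      _ = t / κ / 4 := by rw [hl]; field_simp
      _ ≤ 1 / 4 := by
        have : t / κ ≤ 1 := (div_le_one hκ').mpr htκ
        linarith
  have hexp : -l * (n * t) + n * (2 * (l * v) ^ 2) ≤ -(n * t ^ 2 / (8 * κ ^ 2)) := by
    calc -l * (n * t) + n * (2 * (l * v) ^ 2) ≤ -l * (n * t) + n * (2 * (l * κ) ^ 2) := by gcongr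
      _ = -(n * t ^ 2 / (8 * κ ^ 2)) := by rw [hl]; field_simp; ring
  obtain ⟨i1, m1⟩ := integrable_exp_and_mgf_sum_sq_le hZ hind (t := l) (by rwa [abs_of_pos hlpos])
  obtain ⟨i2, m2⟩ := integrable_exp_and_mgf_sum_sq_le hZ hind (t := -l)
    (by rwa [abs_neg, abs_of_pos hlpos])
  have upper := measure_ge_le_exp_mul_mgf (X := fun ω => ∑ i, Z i ω ^ 2) (n * v + n * t) hlpos.le i1
  have lower := measure_le_le_exp_mul_mgf (X := fun ω => ∑ i, Z i ω ^ 2) (n * v - n * t)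
    (neg_nonpos.mpr hlpos.le) i2
  have upper' : P.real {ω | n * v + n * t ≤ ∑ i, Z i ω ^ 2} ≤
      Real.exp (-(n * t ^ 2 / (8 * κ ^ 2))) := by
    refine upper.trans ((mul_le_mul_of_nonneg_left m1 (Real.exp_pos _).le).trans ?_)
    rw [← Real.exp_add, Real.exp_le_exp]
    linarith
  have lower' : P.real {ω | ∑ i, Z i ω ^ 2 ≤ n * v - n * t} ≤
      Real.exp (-(n * t ^ 2 / (8 * κ ^ 2))) := by
    refine lower.trans ((mul_le_mul_of_nonneg_left m2 (Real.exp_pos _).le).trans ?_)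
    rw [← Real.exp_add, Real.exp_le_exp]
    linarith
  have hsub : {ω | n * t ≤ |∑ i, Z i ω ^ 2 - n * v|} ⊆
      {ω | n * v + n * t ≤ ∑ i, Z i ω ^ 2} ∪ {ω | ∑ i, Z i ω ^ 2 ≤ n * v - n * t} := by
    intro ω hω
    simp only [Set.mem_ofPred_eq] at hω
    rcases le_abs.mp hω with h | h
    · left; simp only [Set.mem_ofPred_eq]; linarith
    · right; simp only [Set.mem_ofPred_eq]; linarith
  calc _ ≤ _ := measureReal_mono hsub
    _ ≤ _ := measureReal_union_le _ _
    _ ≤ _ := by linarith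

lemma hasSubgaussianMGF_of_hasLaw_gaussianReal {Y : Ω → ℝ} (hY : HasLaw Y (gaussianReal 0 v) P)
    (hv : v ≤ κ) : HasSubgaussianMGF Y κ P where
  integrable_exp_mul t := by
    have h := integrable_exp_mul_gaussianReal (μ := 0) (v := v) t
    rw [← hY.map_eq] at h
    exact h.comp_aemeasurable hY.aemeasurable
  mgf_le t := by
    rw [mgf_gaussianReal hY.map_eq]
    have : (v : ℝ) ≤ κ := by exact_mod_cast hv
    simp only [zero_mul, zero_add]
    gcongr

lemma measureReal_abs_sum_le (hZ : ∀ i, HasLaw (Z i) (gaussianReal 0 v) P)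
    (hind : iIndepFun Z P) (hn : 0 < n) (hκ : 0 < κ) (hv : v ≤ κ) {t : ℝ} (ht : 0 < t)
    (htκ : t ≤ κ) :
    P.real {ω | n * √t ≤ |∑ i, Z i ω|} ≤ 2 * Real.exp (-(n * t ^ 2 / (8 * κ ^ 2))) := by
  have : IsProbabilityMeasure P := hind.isProbabilityMeasure
  have hκ' : (0 : ℝ) < κ := by exact_mod_cast hκ
  have hn' : (0 : ℝ) < n := by exact_mod_cast hn
  have hsum := HasSubgaussianMGF.sum_of_iIndepFun hind (c := fun _ => κ) (s := Finset.univ)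
    fun i _ => hasSubgaussianMGF_of_hasLaw_gaussianReal (hZ i) hv
  have hbound : Real.exp (-(n * √t) ^ 2 / (2 * ↑(∑ _i : Fin n, κ))) ≤
      Real.exp (-(n * t ^ 2 / (8 * κ ^ 2))) := by
    rw [Real.exp_le_exp, mul_pow, Real.sq_sqrt ht.le]
    simp only [Finset.sum_const, Finset.card_univ, Fintype.card_fin, nsmul_eq_mul, NNReal.coe_mul,
      NNReal.coe_natCast]
    rw [neg_div, neg_le_neg_iff, div_le_div_iff₀ (by positivity) (by positivity)]
    have : 0 ≤ (n : ℝ) ^ 2 * t * κ * (8 * κ - 2 * t) :=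
      mul_nonneg (by positivity) (by linarith)
    nlinarith
  have h1 := (hsum.measure_ge_le (ε := n * √t) (by positivity)).trans hbound
  have h2 := (hsum.neg.measure_ge_le (ε := n * √t) (by positivity)).trans hbound
  have hsub : {ω | n * √t ≤ |∑ i, Z i ω|} ⊆
      {ω | n * √t ≤ ∑ i, Z i ω} ∪ {ω | n * √t ≤ (-fun ω => ∑ i, Z i ω) ω} := by
    intro ω hω
    simp only [Set.mem_ofPred_eq] at hω
    exact le_abs.mp hω
  calc _ ≤ _ := measureReal_mono hsub
    _ ≤ _ := measureReal_union_le _ _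
    _ ≤ _ := by linarith

/-- Tail bound for the empirical variance of independent centred Gaussian variables. -/
lemma measureReal_empirical_variance_le (hZ : ∀ i, HasLaw (Z i) (gaussianReal 0 v) P)
    (hind : iIndepFun Z P) (hn : 0 < n) (hκ : 0 < κ) (hv : v ≤ κ) {t : ℝ} (ht : 0 < t)
    (htκ : t ≤ κ) :
    P.real {ω | 2 * t < |(∑ i, Z i ω ^ 2) / n - ((∑ i, Z i ω) / n) ^ 2 - v|} ≤
      4 * Real.exp (-(n * t ^ 2 / (8 * κ ^ 2))) := by
  have : IsProbabilityMeasure P := hind.isProbabilityMeasure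
  have hn' : (0 : ℝ) < n := by exact_mod_cast hn
  have hsub : {ω | 2 * t < |(∑ i, Z i ω ^ 2) / n - ((∑ i, Z i ω) / n) ^ 2 - v|} ⊆
      {ω | n * t ≤ |∑ i, Z i ω ^ 2 - n * v|} ∪ {ω | n * √t ≤ |∑ i, Z i ω|} := by
    intro ω hω
    by_contra hcon
    simp only [Set.mem_union, Set.mem_ofPred_eq, not_or, not_le] at hcon hω
    obtain ⟨h1, h2⟩ := hcon
    have h3 : |(∑ i, Z i ω ^ 2) / n - v| < t := by
      have : (∑ i, Z i ω ^ 2) / n - v = (∑ i, Z i ω ^ 2 - n * v) / n := by field_simp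
      rw [this, abs_div, abs_of_pos hn', div_lt_iff₀ hn']
      linarith
    have h4 : ((∑ i, Z i ω) / n) ^ 2 < t := by
      rw [← Real.sq_sqrt ht.le, sq_lt_sq, abs_div, abs_of_pos hn', div_lt_iff₀ hn',
        abs_of_nonneg (Real.sqrt_nonneg _)]
      linarith
    have h5 := sq_nonneg ((∑ i, Z i ω) / n)
    have h6 := abs_lt.mp h3
    have : |(∑ i, Z i ω ^ 2) / n - ((∑ i, Z i ω) / n) ^ 2 - v| ≤ 2 * t := by
      rw [abs_le]; constructor <;> linarith
    linarith
  calc _ ≤ _ := measureReal_mono hsub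
    _ ≤ _ := measureReal_union_le _ _
    _ ≤ _ := by
      linarith [measureReal_sum_sq_sub_le hZ hind hκ hv ht htκ,
        measureReal_abs_sum_le hZ hind hn hκ hv ht htκ]

end GaussianSquares

open Matrix

section SampleCovariance

variable {n p : ℕ}

lemma hasLaw_dotProduct_sub {Ω : Type*} [MeasurableSpace Ω] {P : Measure Ω}
    {X : Ω → EuclideanSpace ℝ (Fin p)} {θ : EuclideanSpace ℝ (Fin p)}
    {S : Matrix (Fin p) (Fin p) ℝ} (hS : S.PosSemidef)
    (hX : HasLaw X (multivariateGaussian θ S) P) (w : Fin p → ℝ) :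
    HasLaw (fun ω => ∑ k, w k * (X ω k - θ k)) (gaussianReal 0 (w ⬝ᵥ S *ᵥ w).toNNReal) P := by
  set L : StrongDual ℝ (EuclideanSpace ℝ (Fin p)) := innerSL ℝ (WithLp.toLp 2 w) with hL
  have hLapp : ∀ y, L y = ∑ k, w k * y k := by
    intro y
    simp [hL, PiLp.inner_apply, mul_comm]
  have hlaw : HasLaw (fun y => L y) (gaussianReal (L θ) (w ⬝ᵥ S *ᵥ w).toNNReal)
      (multivariateGaussian θ S) := by
    refine ⟨by fun_prop, ?_⟩
    rw [IsGaussian.map_eq_gaussianReal]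
    congr 1
    · rw [ContinuousLinearMap.integral_comp_id_comm IsGaussian.integrable_id]
      simp
    · rw [← covarianceBilin_multivariateGaussian (μ := θ) hS (WithLp.toLp 2 w) (WithLp.toLp 2 w),
        covarianceBilin_self IsGaussian.memLp_two_id]
      rfl
  have h := gaussianReal_sub_const (hlaw.fun_comp hX) (L θ)
  rw [sub_self] at h
  refine h.congr (ae_of_all _ fun ω => ?_)
  simp [hLapp, mul_sub]

lemma sampleCov_isSymm (x : Matrix (Fin n) (Fin p) ℝ) : (sampleCov x)ᵀ = sampleCov x := by
  simp [sampleCov, transpose_mul]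

lemma sampleCov_quadForm (x : Matrix (Fin n) (Fin p) ℝ) (w : Fin p → ℝ) :
    w ⬝ᵥ sampleCov x *ᵥ w = (∑ i, (∑ k, centered x i k * w k) ^ 2) / n := by
  rw [sampleCov, smul_mulVec, dotProduct_smul, ← mulVec_mulVec, dotProduct_mulVec,
    vecMul_transpose, smul_eq_mul, div_eq_inv_mul]
  simp [dotProduct, mulVec, sq]

lemma sampleCov_quadForm_nonneg (x : Matrix (Fin n) (Fin p) ℝ) (w : Fin p → ℝ) :
    0 ≤ w ⬝ᵥ sampleCov x *ᵥ w := by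
  rw [sampleCov_quadForm]
  positivity

lemma sampleCov_quadForm_eq_empirical_variance (hn : 0 < n) (x : Matrix (Fin n) (Fin p) ℝ)
    (θ w : Fin p → ℝ) :
    w ⬝ᵥ sampleCov x *ᵥ w = (∑ i, (∑ k, w k * (x i k - θ k)) ^ 2) / n -
      ((∑ i, ∑ k, w k * (x i k - θ k)) / n) ^ 2 := by
  have hn' : (n : ℝ) ≠ 0 := by positivity
  set z : Fin n → ℝ := fun i => ∑ k, w k * (x i k - θ k) with hz
  set m : ℝ := (∑ i, z i) / n with hm
  have hmean : m = ∑ k, w k * (sampleMean x k - θ k) := by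
    rw [hm, hz, Finset.sum_comm, Finset.sum_div]
    refine Finset.sum_congr rfl fun k _ => ?_
    rw [← Finset.mul_sum, Finset.sum_sub_distrib, sampleMean]
    simp
    field_simp
  have hc : ∀ i, ∑ k, centered x i k * w k = z i - m := by
    intro i
    rw [hmean, hz, ← Finset.sum_sub_distrib]
    refine Finset.sum_congr rfl fun k _ => ?_
    simp [centered]
    ring
  rw [sampleCov_quadForm]
  simp_rw [hc, sub_sq]
  rw [Finset.sum_add_distrib, Finset.sum_sub_distrib, ← Finset.sum_mul, ← Finset.mul_sum,
    Finset.sum_const]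
  have : ∑ i, z i = m * n := by rw [hm]; field_simp
  rw [this]
  simp
  field_simp
  ring

lemma dotProduct_mulVec_comm {A : Matrix (Fin p) (Fin p) ℝ} (hA : Aᵀ = A) (u w : Fin p → ℝ) :
    u ⬝ᵥ A *ᵥ w = w ⬝ᵥ A *ᵥ u := by
  rw [dotProduct_mulVec, ← mulVec_transpose, hA, dotProduct_comm]

lemma quadForm_add {A : Matrix (Fin p) (Fin p) ℝ} (hA : Aᵀ = A) (u w : Fin p → ℝ) :
    (u + w) ⬝ᵥ A *ᵥ (u + w) = u ⬝ᵥ A *ᵥ u + 2 * (u ⬝ᵥ A *ᵥ w) + w ⬝ᵥ A *ᵥ w := by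
  rw [mulVec_add, add_dotProduct, dotProduct_add, dotProduct_add, dotProduct_mulVec_comm hA w u]
  ring

lemma quadForm_sub {A : Matrix (Fin p) (Fin p) ℝ} (hA : Aᵀ = A) (u w : Fin p → ℝ) :
    (u - w) ⬝ᵥ A *ᵥ (u - w) = u ⬝ᵥ A *ᵥ u - 2 * (u ⬝ᵥ A *ᵥ w) + w ⬝ᵥ A *ᵥ w := by
  rw [mulVec_sub, sub_dotProduct, dotProduct_sub, dotProduct_sub, dotProduct_mulVec_comm hA w u]
  ring

variable {Ω : Type*} [MeasurableSpace Ω] {P : Measure Ω} {X : Fin n → Ω → EuclideanSpace ℝ (Fin p)}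
  {θ : EuclideanSpace ℝ (Fin p)} {S : Matrix (Fin p) (Fin p) ℝ}

lemma measureReal_sampleCov_quadForm_le (hn : 0 < n) (hS : S.PosSemidef)
    (hX : ∀ i, HasLaw (X i) (multivariateGaussian θ S) P) (hind : iIndepFun X P)
    {w : Fin p → ℝ} {κ : ℝ} (hκ : 0 < κ) (hw : w ⬝ᵥ S *ᵥ w ≤ κ) {t : ℝ} (ht : 0 < t)
    (htκ : t ≤ κ) :
    P.real {ω | 2 * t < |w ⬝ᵥ sampleCov (Matrix.of fun i j => X i ω j) *ᵥ w - w ⬝ᵥ S *ᵥ w|} ≤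
      4 * Real.exp (-(n * t ^ 2 / (8 * κ ^ 2))) := by
  have hnn : 0 ≤ w ⬝ᵥ S *ᵥ w := by simpa using hS.dotProduct_mulVec_nonneg w
  have hindZ : iIndepFun (fun i ω => ∑ k, w k * (X i ω k - θ k)) P :=
    hind.comp (fun _ y => ∑ k, w k * (y k - θ k)) fun _ => by fun_prop
  have h := measureReal_empirical_variance_le (κ := κ.toNNReal)
    (fun i => hasLaw_dotProduct_sub hS (hX i) w) hindZ hn (Real.toNNReal_pos.mpr hκ)
    (Real.toNNReal_le_toNNReal hw) ht (by rwa [Real.coe_toNNReal _ hκ.le])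
  rw [Real.coe_toNNReal _ hκ.le, Real.coe_toNNReal _ hnn] at h
  convert h using 5 with ω
  rw [sampleCov_quadForm_eq_empirical_variance hn _ θ w]
  rfl

/-- Concentration of the bilinear forms of the sample covariance matrix. -/
lemma measureReal_sampleCov_bilin_le (hn : 0 < n) (hS : S.PosSemidef)
    (hX : ∀ i, HasLaw (X i) (multivariateGaussian θ S) P) (hind : iIndepFun X P)
    {u w : Fin p → ℝ} {c : ℝ} (hc : 0 < c) (hu : u ⬝ᵥ S *ᵥ u ≤ c) (hw : w ⬝ᵥ S *ᵥ w ≤ c) {t : ℝ}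
    (ht : 0 < t) (htc : t ≤ 4 * c) :
    P.real {ω | t < |u ⬝ᵥ sampleCov (Matrix.of fun i j => X i ω j) *ᵥ w - u ⬝ᵥ S *ᵥ w|} ≤
      8 * Real.exp (-(n * t ^ 2 / (128 * c ^ 2))) := by
  have : IsProbabilityMeasure P := hind.isProbabilityMeasure
  have hsymm : Sᵀ = S := by simpa using hS.isHermitian.eq
  have hnn : ∀ w : Fin p → ℝ, 0 ≤ w ⬝ᵥ S *ᵥ w := fun w => by
    simpa using hS.dotProduct_mulVec_nonneg w
  have hp := quadForm_add hsymm u w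
  have hm := quadForm_sub hsymm u w
  have h1 := measureReal_sampleCov_quadForm_le hn hS hX hind (w := u + w) (κ := 4 * c)
    (by positivity) (by linarith [hnn (u - w)]) ht htc
  have h2 := measureReal_sampleCov_quadForm_le hn hS hX hind (w := u - w) (κ := 4 * c)
    (by positivity) (by linarith [hnn (u + w)]) ht htc
  rw [show 8 * (4 * c) ^ 2 = 128 * c ^ 2 by ring] at h1 h2
  set H : Ω → Matrix (Fin p) (Fin p) ℝ := fun ω => sampleCov (Matrix.of fun i j => X i ω j) with hH
  have hsub : {ω | t < |u ⬝ᵥ H ω *ᵥ w - u ⬝ᵥ S *ᵥ w|} ⊆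
      {ω | 2 * t < |(u + w) ⬝ᵥ H ω *ᵥ (u + w) - (u + w) ⬝ᵥ S *ᵥ (u + w)|} ∪
      {ω | 2 * t < |(u - w) ⬝ᵥ H ω *ᵥ (u - w) - (u - w) ⬝ᵥ S *ᵥ (u - w)|} := by
    intro ω hω
    by_contra hcon
    simp only [Set.mem_union, Set.mem_ofPred_eq, not_or, not_lt] at hcon hω
    obtain ⟨b1, b2⟩ := hcon
    have hHs : (H ω)ᵀ = H ω := sampleCov_isSymm _
    rw [quadForm_add hHs, hp, abs_le] at b1
    rw [quadForm_sub hHs, hm, abs_le] at b2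
    have : |u ⬝ᵥ H ω *ᵥ w - u ⬝ᵥ S *ᵥ w| ≤ t := by
      rw [abs_le]; constructor <;> linarith [b1.1, b1.2, b2.1, b2.2]
    linarith
  calc _ ≤ _ := measureReal_mono hsub
    _ ≤ _ := measureReal_union_le _ _
    _ ≤ _ := by linarith

end SampleCovariance

/-! ### Deterministic analysis of a nodewise Lasso regression -/

section Lasso

variable {n p : ℕ}

/-- The vector with entry `1` at `j` and entries `-γ k` elsewhere. -/
noncomputable def contrast (j : Fin p) (γ : {k : Fin p // k ≠ j} → ℝ) (k : Fin p) : ℝ :=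
  if h : k = j then 1 else -γ ⟨k, h⟩

@[simp]
lemma contrast_self (j : Fin p) (γ : {k : Fin p // k ≠ j} → ℝ) : contrast j γ j = 1 := by
  simp [contrast]

lemma contrast_ne {j : Fin p} (γ : {k : Fin p // k ≠ j} → ℝ) (k : {k : Fin p // k ≠ j}) :
    contrast j γ k = -γ k := by
  simp [contrast, k.2]

lemma coefMatrix_apply (γ : ∀ j : Fin p, {k : Fin p // k ≠ j} → ℝ) (j k : Fin p) :
    coefMatrix γ j k = contrast j (γ j) k := rfl

lemma residualMeanSq_eq (x : Matrix (Fin n) (Fin p) ℝ) (j : Fin p)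
    (γ : {k : Fin p // k ≠ j} → ℝ) :
    residualMeanSq x j γ = contrast j γ ⬝ᵥ sampleCov x *ᵥ contrast j γ := by
  rw [sampleCov_quadForm, residualMeanSq]
  congr 1
  refine Finset.sum_congr rfl fun i _ => ?_
  rw [Fintype.sum_eq_add_sum_subtype_ne _ j]
  simp [contrast_ne, sub_eq_add_neg]

lemma sum_abs_contrast (j : Fin p) (γ : {k : Fin p // k ≠ j} → ℝ) :
    ∑ k, |contrast j γ k| = 1 + ∑ k, |γ k| := by
  rw [Fintype.sum_eq_add_sum_subtype_ne _ j]
  simp [contrast_ne]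

/-- `c` minimises `c ↦ cᵀ H c + 2 lam |c|₁` among the vectors with `c j = 1`. -/
def IsContrastMin (H : Matrix (Fin p) (Fin p) ℝ) (lam : ℝ) (j : Fin p) (c : Fin p → ℝ) : Prop :=
  c j = 1 ∧ ∀ c' : Fin p → ℝ, c' j = 1 →
    c ⬝ᵥ H *ᵥ c + 2 * lam * ∑ k, |c k| ≤ c' ⬝ᵥ H *ᵥ c' + 2 * lam * ∑ k, |c' k|

lemma IsLassoSolution.isContrastMin {x : Matrix (Fin n) (Fin p) ℝ} {lam : ℝ} {j : Fin p}
    {γ : {k : Fin p // k ≠ j} → ℝ} (h : IsLassoSolution x lam j γ) :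
    IsContrastMin (sampleCov x) lam j (contrast j γ) := by
  refine ⟨contrast_self j γ, fun c' hc' => ?_⟩
  have hc : c' = contrast j (fun k => -c' k) := by
    ext k
    by_cases hk : k = j
    · subst hk; simp [hc']
    · simp [contrast, hk]
  have hmin := (isMinOn_iff.mp h) (fun k => -c' k) (Set.mem_univ _)
  rw [hc]
  simp only [residualMeanSq_eq] at hmin
  rw [sum_abs_contrast, sum_abs_contrast]
  linarith

lemma abs_le_of_forall_quadratic_nonneg {a b l : ℝ}
    (h : ∀ t : ℝ, |t| ≤ 1 → 0 ≤ 2 * t * a + t ^ 2 * b + 2 * l * |t|) : |a| ≤ l := by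
  have aux : ∀ a : ℝ, (∀ t : ℝ, |t| ≤ 1 → 0 ≤ 2 * t * a + t ^ 2 * b + 2 * l * |t|) → a ≤ l := by
    intro a h
    by_contra! hcon
    set m : ℝ := |b| + (a - l) with hm
    have hmpos : 0 < m := by positivity [sub_pos.mpr hcon]
    set s : ℝ := (a - l) / m with hs
    have hspos : 0 < s := div_pos (sub_pos.mpr hcon) hmpos
    have hs1 : s ≤ 1 := (div_le_one hmpos).mpr (by linarith [abs_nonneg b])
    have hsm : s * m = a - l := by rw [hs]; field_simp
    have h1 := h (-s) (by rwa [abs_neg, abs_of_pos hspos])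
    rw [abs_neg, abs_of_pos hspos] at h1
    have h2 : 0 ≤ s * (s * b - 2 * (a - l)) := by linarith
    have h3 : 0 ≤ s * b - 2 * (a - l) := nonneg_of_mul_nonneg_right h2 hspos
    have h4 : s * b ≤ s * m :=
      mul_le_mul_of_nonneg_left (by linarith [le_abs_self b]) hspos.le
    linarith
  refine abs_le'.mpr ⟨aux a h, aux (-a) fun t ht => ?_⟩
  have := h (-t) (by rwa [abs_neg])
  rw [abs_neg] at this
  linarith

lemma quadForm_smul (H : Matrix (Fin p) (Fin p) ℝ) (t : ℝ) (w : Fin p → ℝ) :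
    (t • w) ⬝ᵥ H *ᵥ (t • w) = t ^ 2 * (w ⬝ᵥ H *ᵥ w) := by
  rw [mulVec_smul, smul_dotProduct, dotProduct_smul, smul_eq_mul, smul_eq_mul]
  ring

variable {H : Matrix (Fin p) (Fin p) ℝ} {lam : ℝ} {j : Fin p} {c : Fin p → ℝ}

lemma IsContrastMin.abs_mulVec_le (hH : Hᵀ = H) (hlam : 0 ≤ lam) (h : IsContrastMin H lam j c)
    {k : Fin p} (hk : k ≠ j) : |(H *ᵥ c) k| ≤ lam := by
  refine abs_le_of_forall_quadratic_nonneg (b := Pi.single k 1 ⬝ᵥ H *ᵥ Pi.single k 1)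
    fun t _ => ?_
  have h1 := h.2 (c + t • Pi.single k 1) (by simp [h.1, hk.symm])
  rw [quadForm_add hH, quadForm_smul, dotProduct_mulVec_comm hH c (t • _), smul_dotProduct,
    single_one_dotProduct] at h1
  have h2 : ∑ i, |(c + t • Pi.single k (1 : ℝ) : Fin p → ℝ) i| ≤ ∑ i, |c i| + |t| := by
    calc _ ≤ ∑ i, (|c i| + |(t • Pi.single k (1 : ℝ) : Fin p → ℝ) i|) :=
          Finset.sum_le_sum fun i _ => abs_add_le _ _
      _ = _ := by
        rw [Finset.sum_add_distrib]
        congr 1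
        rw [Finset.sum_eq_single k] <;> simp +contextual
  have h3 := mul_le_mul_of_nonneg_left h2 (by positivity : 0 ≤ 2 * lam)
  rw [smul_eq_mul] at h1
  linarith

lemma IsContrastMin.mulVec_self (hH : Hᵀ = H) (h : IsContrastMin H lam j c) :
    (H *ᵥ c) j = c ⬝ᵥ H *ᵥ c + lam * (∑ k, |c k| - 1) := by
  set e : Fin p → ℝ := Pi.single j 1 with he
  have hz : |(c - e) ⬝ᵥ H *ᵥ c + lam * (∑ k, |c k| - 1)| ≤ 0 := by
    refine abs_le_of_forall_quadratic_nonneg (b := (c - e) ⬝ᵥ H *ᵥ (c - e)) fun t ht => ?_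
    have ht' : 0 ≤ 1 + t := by linarith [(abs_le.mp ht).1]
    have h1 := h.2 (c + t • (c - e)) (by simp [h.1, he])
    rw [quadForm_add hH, quadForm_smul, dotProduct_mulVec_comm hH c (t • (c - e)),
      smul_dotProduct, smul_eq_mul] at h1
    have h2 : ∑ i, |(c + t • (c - e)) i| = ∑ i, |c i| + t * (∑ i, |c i| - 1) := by
      rw [Fintype.sum_eq_add_sum_subtype_ne _ j,
        Fintype.sum_eq_add_sum_subtype_ne (fun i => |c i|) j]
      have h3 : ∀ k : {k : Fin p // k ≠ j}, |(c + t • (c - e)) k| = (1 + t) * |c k| := by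
        intro k
        conv_rhs => rw [← abs_of_nonneg ht', ← abs_mul]
        congr 1
        simp [he, k.2]
        ring
      simp_rw [h3, ← Finset.mul_sum]
      simp [he, h.1]
      ring
    rw [h2] at h1
    linarith
  have hz' := abs_nonpos_iff.mp hz
  rw [sub_dotProduct, he, single_one_dotProduct] at hz'
  linarith

lemma abs_dotProduct_le {v w : Fin p → ℝ} {a : ℝ} (h : ∀ k, v k ≠ 0 → |w k| ≤ a) :
    |v ⬝ᵥ w| ≤ a * ∑ k, |v k| := by
  rw [dotProduct, Finset.mul_sum]
  refine (Finset.abs_sum_le_sum_abs _ _).trans (Finset.sum_le_sum fun k _ => ?_)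
  rw [abs_mul, mul_comm]
  by_cases hk : v k = 0
  · simp [hk]
  · exact mul_le_mul_of_nonneg_right (h k hk) (abs_nonneg _)

variable {c₀ : Fin p → ℝ}

lemma IsContrastMin.basic_inequality (hH : Hᵀ = H) (h : IsContrastMin H lam j c)
    (hc₀ : c₀ j = 1) :
    (c - c₀) ⬝ᵥ H *ᵥ (c - c₀) ≤
      -2 * ((c - c₀) ⬝ᵥ H *ᵥ c₀) + 2 * lam * (∑ k, |c₀ k| - ∑ k, |c k|) := by
  have h1 := h.2 c₀ hc₀
  have h2 := quadForm_add hH c₀ (c - c₀)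
  rw [add_sub_cancel, dotProduct_mulVec_comm hH c₀ (c - c₀)] at h2
  linarith

lemma sum_abs_sub_sum_abs_le (c c₀ : Fin p → ℝ) :
    ∑ k, |c₀ k| - ∑ k, |c k| ≤ ∑ k, |(c - c₀) k| := by
  rw [← Finset.sum_sub_distrib]
  refine Finset.sum_le_sum fun k _ => ?_
  rw [Pi.sub_apply, abs_sub_comm]
  exact abs_sub_abs_le_abs_sub _ _

/-- The estimation error lies in the usual cone when the penalty dominates the noise. -/
lemma IsContrastMin.sq_sum_abs_le (hH : Hᵀ = H) (hpos : ∀ w, 0 ≤ w ⬝ᵥ H *ᵥ w) (hlam : 0 < lam)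
    (h : IsContrastMin H lam j c) (hc₀ : c₀ j = 1)
    (hnoise : ∀ k, k ≠ j → |(H *ᵥ c₀) k| ≤ lam / 2) {d : ℕ}
    (hd : {k : Fin p | k ≠ j ∧ c₀ k ≠ 0}.ncard ≤ d) :
    (∑ k, |(c - c₀) k|) ^ 2 ≤ 16 * d * ∑ k, (c - c₀) k ^ 2 := by
  classical
  set v := c - c₀ with hv
  have hvj : v j = 0 := by simp [hv, h.1, hc₀]
  set T : Finset (Fin p) := Finset.univ.filter fun k => k ≠ j ∧ c₀ k ≠ 0 with hT
  have hTd : (T.card : ℝ) ≤ d := by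
    have : {k : Fin p | k ≠ j ∧ c₀ k ≠ 0} = (T : Set (Fin p)) := by ext; simp [hT]
    rw [this, Set.ncard_coe_finset] at hd
    exact_mod_cast hd
  have hb := h.basic_inequality hH hc₀
  have hn : |v ⬝ᵥ H *ᵥ c₀| ≤ lam / 2 * ∑ k, |v k| :=
    abs_dotProduct_le fun k hk => hnoise k (by rintro rfl; exact hk hvj)
  have hl : ∑ k, |c₀ k| - ∑ k, |c k| ≤ 2 * ∑ k ∈ T, |v k| - ∑ k, |v k| := by
    rw [hT, Finset.sum_filter, Finset.mul_sum, ← Finset.sum_sub_distrib, ← Finset.sum_sub_distrib]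
    refine Finset.sum_le_sum fun k _ => ?_
    by_cases hk : k ≠ j ∧ c₀ k ≠ 0
    · rw [if_pos hk, hv, Pi.sub_apply]
      linarith [abs_sub_abs_le_abs_sub (c₀ k) (c k), abs_sub_comm (c₀ k) (c k)]
    · rw [if_neg hk]
      by_cases hkj : k = j
      · subst hkj; simp [hvj, hc₀, h.1]
      · have : c₀ k = 0 := by simpa [hkj] using hk
        simp [hv, this]
  have hcone : ∑ k, |v k| ≤ 4 * ∑ k ∈ T, |v k| := by
    have h1 := (abs_le.mp hn).1
    have h2 := mul_le_mul_of_nonneg_left hl (by positivity : 0 ≤ 2 * lam)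
    have h3 := hpos v
    have : 0 ≤ lam * (4 * ∑ k ∈ T, |v k| - ∑ k, |v k|) := by linarith
    linarith [nonneg_of_mul_nonneg_right this hlam]
  calc (∑ k, |v k|) ^ 2 ≤ (4 * ∑ k ∈ T, |v k|) ^ 2 :=
        pow_le_pow_left₀ (Finset.sum_nonneg fun _ _ => abs_nonneg _) hcone 2
    _ = 16 * (∑ k ∈ T, |v k|) ^ 2 := by ring
    _ ≤ 16 * (T.card * ∑ k ∈ T, |v k| ^ 2) := by gcongr; exact sq_sum_le_card_mul_sum_sq
    _ ≤ 16 * (d * ∑ k, v k ^ 2) := by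
        simp_rw [sq_abs]
        gcongr
        exact Finset.subset_univ _
    _ = _ := by ring

lemma sq_dotProduct_mulVec_le (hH : Hᵀ = H) (hpos : ∀ w, 0 ≤ w ⬝ᵥ H *ᵥ w) (u w : Fin p → ℝ) :
    (u ⬝ᵥ H *ᵥ w) ^ 2 ≤ (u ⬝ᵥ H *ᵥ u) * (w ⬝ᵥ H *ᵥ w) := by
  have h := discrim_le_zero (a := u ⬝ᵥ H *ᵥ u) (b := 2 * (u ⬝ᵥ H *ᵥ w)) (c := w ⬝ᵥ H *ᵥ w)
    fun t => by
      have h1 := hpos (t • u + w)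
      rw [quadForm_add hH, quadForm_smul, smul_dotProduct, smul_eq_mul] at h1
      linarith
  rw [discrim] at h
  linarith

lemma abs_quadForm_sub_le {S : Matrix (Fin p) (Fin p) ℝ} {δ : ℝ}
    (h : ∀ k l, |H k l - S k l| ≤ δ) (v : Fin p → ℝ) :
    |v ⬝ᵥ H *ᵥ v - v ⬝ᵥ S *ᵥ v| ≤ δ * (∑ k, |v k|) ^ 2 := by
  rw [← dotProduct_sub, ← sub_mulVec, sq, ← mul_assoc]
  refine abs_dotProduct_le fun k _ => ?_
  rw [mulVec, dotProduct_comm]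
  exact abs_dotProduct_le fun l _ => h k l

variable {S : Matrix (Fin p) (Fin p) ℝ} {c₁ c₂ A B M d r : ℝ}

/-- The `ℓ¹` error and the prediction error of the Lasso. -/
lemma IsContrastMin.sum_abs_sub_le (hH : Hᵀ = H)
    (h : IsContrastMin H lam j c) (hc₀ : c₀ j = 1) (hc₂ : 0 < c₂)
    (hS : ∀ w : Fin p → ℝ, c₂ * ∑ k, w k ^ 2 ≤ w ⬝ᵥ S *ᵥ w)
    (hM : 0 ≤ M) (hB : 0 ≤ B) (hd : 0 ≤ d) (hr : 0 ≤ r) (hlam : 0 ≤ lam) (hlamA : lam ≤ A * r)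
    (hHS : ∀ k l, |H k l - S k l| ≤ M * r)
    (hnoise : ∀ k, k ≠ j → |(H *ᵥ c₀) k| ≤ M * r)
    (hcone : (∑ k, |(c - c₀) k|) ^ 2 ≤ B * d * ∑ k, (c - c₀) k ^ 2)
    (hsmall : M * r * (B * d) ≤ c₂ / 2) :
    ∑ k, |(c - c₀) k| ≤ 4 * (M + A) / c₂ * B * (d * r) ∧
    (c - c₀) ⬝ᵥ H *ᵥ (c - c₀) ≤ 2 * ((M + A) * r) * ∑ k, |(c - c₀) k| := by
  set v := c - c₀ with hv
  set W := ∑ k, |v k| with hW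
  set V := ∑ k, v k ^ 2 with hV
  have hW0 : 0 ≤ W := Finset.sum_nonneg fun _ _ => abs_nonneg _
  have hV0 : 0 ≤ V := Finset.sum_nonneg fun _ _ => sq_nonneg _
  have hvj : v j = 0 := by simp [hv, h.1, hc₀]
  have hn : |v ⬝ᵥ H *ᵥ c₀| ≤ M * r * W :=
    abs_dotProduct_le fun k hk => hnoise k (by rintro rfl; exact hk hvj)
  have hupper : v ⬝ᵥ H *ᵥ v ≤ 2 * ((M + A) * r) * W := by
    have h1 := h.basic_inequality hH hc₀
    have h2 := mul_le_mul_of_nonneg_left (sum_abs_sub_sum_abs_le c c₀)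
      (by positivity : 0 ≤ 2 * lam)
    have h3 := mul_le_mul_of_nonneg_right hlamA hW0
    linarith [(abs_le.mp hn).1]
  refine ⟨?_, hupper⟩
  have hlower : c₂ / 2 * V ≤ v ⬝ᵥ H *ᵥ v := by
    have h1 := (abs_le.mp (abs_quadForm_sub_le hHS v)).1
    have h2 := hS v
    have h3 : M * r * W ^ 2 ≤ M * r * (B * d * V) :=
      mul_le_mul_of_nonneg_left hcone (by positivity)
    have h4 := mul_le_mul_of_nonneg_right hsmall hV0
    linarith
  have hVW : V ≤ 4 * (M + A) / c₂ * r * W := by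
    have : V = 2 / c₂ * (c₂ / 2 * V) := by field_simp
    rw [this]
    calc 2 / c₂ * (c₂ / 2 * V) ≤ 2 / c₂ * (2 * ((M + A) * r) * W) := by
          exact mul_le_mul_of_nonneg_left (hlower.trans hupper) (by positivity)
      _ = _ := by ring
  rcases hW0.eq_or_lt with h0 | h0
  · have hA : 0 ≤ (M + A) * r := by linarith [mul_nonneg hM hr]
    rw [← h0]
    have : 4 * (M + A) / c₂ * B * (d * r) = 4 / c₂ * B * d * ((M + A) * r) := by ring
    rw [this]
    positivity
  · have : W * W ≤ 4 * (M + A) / c₂ * B * (d * r) * W := by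
      calc W * W = W ^ 2 := (sq W).symm
        _ ≤ B * d * V := hcone
        _ ≤ B * d * (4 * (M + A) / c₂ * r * W) := by gcongr
        _ = _ := by ring
    exact le_of_mul_le_mul_right this h0

lemma IsContrastMin.abs_mulVec_sub_le (hH : Hᵀ = H) (hpos : ∀ w, 0 ≤ w ⬝ᵥ H *ᵥ w)
    (h : IsContrastMin H lam j c) (hc₀ : c₀ j = 1) (hc₂ : 0 < c₂)
    (hS : ∀ w : Fin p → ℝ, c₂ * ∑ k, w k ^ 2 ≤ w ⬝ᵥ S *ᵥ w) (hSj : S j j ≤ c₁)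
    (hM : 0 ≤ M) (hA : 0 ≤ A) (hB : 0 ≤ B) (hd : 1 ≤ d) (hr : 0 ≤ r) (hlam : 0 ≤ lam)
    (hlamA : lam ≤ A * r)
    (hHS : ∀ k l, |H k l - S k l| ≤ M * r)
    (hnoise : ∀ k, |(H *ᵥ c₀) k - (S *ᵥ c₀) k| ≤ M * r) (hSc₀ : ∀ k, k ≠ j → (S *ᵥ c₀) k = 0)
    (hcone : (∑ k, |(c - c₀) k|) ^ 2 ≤ B * d * ∑ k, (c - c₀) k ^ 2)
    (hsmall : M * r * (B * d) ≤ c₂ / 2) (hsmall' : M * r ≤ c₁) :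
    |(H *ᵥ c) j - (S *ᵥ c₀) j| ≤
      (M + √(16 * c₁ * (M + A) ^ 2 / c₂ * B)) * (√d * r) := by
  obtain ⟨hl1, hq⟩ := h.sum_abs_sub_le hH hc₀ hc₂ hS hM hB (by linarith) hr hlam hlamA hHS
    (fun k hk => by simpa [hSc₀ k hk] using hnoise k) hcone hsmall
  set v := c - c₀ with hv
  have hc₁ : 0 ≤ c₁ := le_trans (by positivity) hsmall'
  have hq' : v ⬝ᵥ H *ᵥ v ≤ 8 * (M + A) ^ 2 / c₂ * B * (d * r ^ 2) := by
    calc _ ≤ _ := hq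
      _ ≤ 2 * ((M + A) * r) * (4 * (M + A) / c₂ * B * (d * r)) := by gcongr
      _ = _ := by ring
  have hHj : H j j ≤ 2 * c₁ := by linarith [(abs_le.mp (hHS j j)).2]
  have hcs := sq_dotProduct_mulVec_le hH hpos (Pi.single j 1) v
  have hjj : Pi.single j 1 ⬝ᵥ H *ᵥ Pi.single j 1 = H j j := by simp
  rw [hjj, single_one_dotProduct] at hcs
  have hvj : |(H *ᵥ v) j| ≤ √(16 * c₁ * (M + A) ^ 2 / c₂ * B) * (√d * r) := by
    rw [← Real.sqrt_sq hr, ← Real.sqrt_mul (by linarith), ← Real.sqrt_mul (by positivity)]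
    refine Real.abs_le_sqrt (hcs.trans ?_)
    calc H j j * (v ⬝ᵥ H *ᵥ v) ≤ 2 * c₁ * (8 * (M + A) ^ 2 / c₂ * B * (d * r ^ 2)) :=
          mul_le_mul hHj hq' (hpos v) (by positivity)
      _ = _ := by ring
  have hsplit : (H *ᵥ c) j - (S *ᵥ c₀) j = ((H *ᵥ c₀) j - (S *ᵥ c₀) j) + (H *ᵥ v) j := by
    rw [hv, mulVec_sub, Pi.sub_apply]; ring
  have hsd : 1 ≤ √d := Real.one_le_sqrt.mpr hd
  have hMd : M * r ≤ M * (√d * r) := by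
    have := mul_le_mul_of_nonneg_right hsd hr
    rw [one_mul] at this
    gcongr
  rw [hsplit, add_mul]
  exact (abs_add_le _ _).trans (add_le_add ((hnoise j).trans hMd) hvj)

end Lasso

/-! ### The population regression coefficients -/

section Population

variable {p : ℕ} {S : Matrix (Fin p) (Fin p) ℝ} {c₁ c₂ : ℝ}

lemma le_quadForm_of_lt_eigenvalues (hS : S.IsHermitian) (h : ∀ j, c₂ < hS.eigenvalues j)
    (w : Fin p → ℝ) : c₂ * ∑ k, w k ^ 2 ≤ w ⬝ᵥ S *ᵥ w := by
  have hsymm : Sᵀ = S := by simpa using hS.eq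
  set b := hS.eigenvectorBasis with hb
  set y : EuclideanSpace ℝ (Fin p) := WithLp.toLp 2 w with hy
  have e1 : w ⬝ᵥ S *ᵥ w = ∑ i, hS.eigenvalues i * inner ℝ (b i) y ^ 2 := by
    have h1 : w ⬝ᵥ S *ᵥ w = inner ℝ y (WithLp.toLp 2 (S *ᵥ w)) := by
      simp [hy, PiLp.inner_apply, dotProduct, mul_comm]
    rw [h1, ← b.sum_inner_mul_inner]
    refine Finset.sum_congr rfl fun i _ => ?_
    have h2 : inner ℝ (b i) (WithLp.toLp 2 (S *ᵥ w)) = hS.eigenvalues i * inner ℝ (b i) y := by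
      have h3 : inner ℝ (b i) (WithLp.toLp 2 (S *ᵥ w)) = (b i).ofLp ⬝ᵥ S *ᵥ w := by
        simp [PiLp.inner_apply, dotProduct, mul_comm]
      rw [h3, dotProduct_mulVec_comm hsymm, hb, hS.mulVec_eigenvectorBasis, dotProduct_smul]
      simp [hy, PiLp.inner_apply, dotProduct]
    rw [h2, real_inner_comm]
    ring
  have e2 : ∑ k, w k ^ 2 = ∑ i, inner ℝ (b i) y ^ 2 := by
    rw [b.sum_sq_inner_right, EuclideanSpace.real_norm_sq_eq]
  rw [e1, e2, Finset.mul_sum]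
  exact Finset.sum_le_sum fun i _ => mul_le_mul_of_nonneg_right (h i).le (sq_nonneg _)

lemma posDef_of_le_quadForm (hS : S.IsHermitian) (hc₂ : 0 < c₂)
    (h : ∀ w : Fin p → ℝ, c₂ * ∑ k, w k ^ 2 ≤ w ⬝ᵥ S *ᵥ w) : S.PosDef := by
  refine PosDef.of_dotProduct_mulVec_pos hS fun w hw => ?_
  obtain ⟨k, hk⟩ := Function.ne_iff.mp hw
  have : 0 < ∑ k, w k ^ 2 :=
    Finset.sum_pos' (fun _ _ => sq_nonneg _) ⟨k, Finset.mem_univ _, sq_pos_iff.mpr hk⟩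
  simpa using (mul_pos hc₂ this).trans_le (h w)

/-- The row `j` of `S⁻¹`, normalised to have entry `1` at `j`. -/
noncomputable def popContrast (S : Matrix (Fin p) (Fin p) ℝ) (j : Fin p) : Fin p → ℝ :=
  (S⁻¹ j j)⁻¹ • S⁻¹ j

lemma popContrast_self (hS : S.PosDef) (j : Fin p) : popContrast S j j = 1 := by
  have := hS.inv.diag_pos (i := j)
  simp [popContrast, this.ne']

lemma mulVec_popContrast (hS : S.PosDef) (j : Fin p) :
    S *ᵥ popContrast S j = (S⁻¹ j j)⁻¹ • Pi.single j 1 := by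
  have hsymm : (S⁻¹)ᵀ = S⁻¹ := by simpa using hS.inv.isHermitian.eq
  rw [popContrast, mulVec_smul]
  congr 1
  have h1 : S⁻¹ j = S⁻¹ *ᵥ Pi.single j 1 := by
    ext k
    rw [mulVec_single_one, col_apply]
    exact congrFun (congrFun hsymm k) j
  rw [h1, mulVec_mulVec, mul_nonsing_inv _ ((isUnit_iff_isUnit_det _).mp hS.isUnit), one_mulVec]

lemma mulVec_popContrast_ne (hS : S.PosDef) {j k : Fin p} (hk : k ≠ j) :
    (S *ᵥ popContrast S j) k = 0 := by
  simp [mulVec_popContrast hS, hk]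

lemma mulVec_popContrast_self (hS : S.PosDef) (j : Fin p) :
    (S *ᵥ popContrast S j) j = (S⁻¹ j j)⁻¹ := by
  simp [mulVec_popContrast hS]

lemma quadForm_popContrast (hS : S.PosDef) (j : Fin p) :
    popContrast S j ⬝ᵥ S *ᵥ popContrast S j = (S⁻¹ j j)⁻¹ := by
  rw [mulVec_popContrast hS, dotProduct_smul, dotProduct_single_one, popContrast_self hS]
  simp

lemma le_inv_diag_inv (hS : S.PosDef) (hc₂ : 0 < c₂)
    (h : ∀ w : Fin p → ℝ, c₂ * ∑ k, w k ^ 2 ≤ w ⬝ᵥ S *ᵥ w) (j : Fin p) :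
    c₂ ≤ (S⁻¹ j j)⁻¹ := by
  have h1 := h (popContrast S j)
  rw [quadForm_popContrast hS] at h1
  have h2 : popContrast S j j ^ 2 ≤ ∑ k, popContrast S j k ^ 2 :=
    Finset.single_le_sum (f := fun k => popContrast S j k ^ 2) (fun _ _ => sq_nonneg _)
      (Finset.mem_univ j)
  rw [popContrast_self hS, one_pow] at h2
  nlinarith

lemma inv_diag_inv_le (hS : S.PosDef) (j : Fin p) : (S⁻¹ j j)⁻¹ ≤ S j j := by
  have hsymm : Sᵀ = S := by simpa using hS.isHermitian.eq
  have h := sq_dotProduct_mulVec_le hsymm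
    (fun w => by simpa using hS.posSemidef.dotProduct_mulVec_nonneg w) (Pi.single j 1)
    (popContrast S j)
  rw [quadForm_popContrast hS, single_one_dotProduct, mulVec_popContrast_self hS] at h
  have hpos : 0 < (S⁻¹ j j)⁻¹ := inv_pos.mpr hS.inv.diag_pos
  rw [sq, show Pi.single j 1 ⬝ᵥ S *ᵥ Pi.single j 1 = S j j by simp] at h
  exact le_of_mul_le_mul_right h hpos

lemma ncard_popContrast_le (j : Fin p) :
    {k : Fin p | k ≠ j ∧ popContrast S j k ≠ 0}.ncard ≤ rowSparsity S⁻¹ := by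
  refine le_trans (Set.ncard_le_ncard ?_ (Set.toFinite _)) (Finset.le_sup
    (f := fun j => {k : Fin p | k ≠ j ∧ S⁻¹ j k ≠ 0}.ncard) (Finset.mem_univ j))
  rintro k ⟨h1, h2⟩
  refine ⟨h1, fun h3 => h2 ?_⟩
  simp [popContrast, h3]

lemma sum_abs_popContrast_le (hS : S.PosDef) (hc₂ : 0 < c₂)
    (h : ∀ w : Fin p → ℝ, c₂ * ∑ k, w k ^ 2 ≤ w ⬝ᵥ S *ᵥ w) {j : Fin p} (hj : S j j ≤ c₁)
    {d : ℕ} (hd1 : 1 ≤ d) (hd : rowSparsity S⁻¹ ≤ d) :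
    ∑ k, |popContrast S j k| ≤ √(2 * c₁ / c₂) * √d := by
  classical
  set u := popContrast S j with hu
  set T : Finset (Fin p) := Finset.univ.filter fun k => k ≠ j ∧ u k ≠ 0 with hT
  have hTd : T.card ≤ d := by
    have h1 := (ncard_popContrast_le (S := S) j).trans hd
    have : {k : Fin p | k ≠ j ∧ u k ≠ 0} = (T : Set (Fin p)) := by ext; simp [hT]
    rwa [← hu, this, Set.ncard_coe_finset] at h1
  have hcard : ((insert j T).card : ℝ) ≤ 2 * d := by
    have := Finset.card_insert_le j T
    exact_mod_cast (by omega : (insert j T).card ≤ 2 * d)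
  have hsum : ∑ k, |u k| = ∑ k ∈ insert j T, |u k| := by
    refine (Finset.sum_subset (Finset.subset_univ _) fun k _ hk => ?_).symm
    simp only [hT, Finset.mem_insert, Finset.mem_filter, Finset.mem_univ, true_and, not_or,
      not_and, not_not] at hk
    simp [hk.2 hk.1]
  have hl2 : ∑ k, u k ^ 2 ≤ c₁ / c₂ := by
    rw [le_div_iff₀ hc₂, mul_comm]
    refine (h u).trans ?_
    rw [hu, quadForm_popContrast hS]
    exact (inv_diag_inv_le hS j).trans hj
  have hc₁ : 0 ≤ c₁ := hS.diag_pos.le.trans hj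
  rw [← Real.sqrt_mul (by positivity)]
  refine Real.le_sqrt_of_sq_le ?_
  calc (∑ k, |u k|) ^ 2 = (∑ k ∈ insert j T, |u k|) ^ 2 := by rw [hsum]
    _ ≤ (insert j T).card * ∑ k ∈ insert j T, |u k| ^ 2 := sq_sum_le_card_mul_sum_sq
    _ ≤ 2 * d * ∑ k, u k ^ 2 := by
      simp_rw [sq_abs]
      gcongr
      exact Finset.subset_univ _
    _ ≤ 2 * d * (c₁ / c₂) := by gcongr
    _ = _ := by ring

end Population

/-! ### Deterministic bounds for the nodewise Lasso estimator -/

section Estimator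

variable {n p : ℕ}

/-- The good event: `H` is close to `S`, entrywise and along the population contrasts, and either
the penalties dominate the noise or the dimension is at most `B`. -/
structure GoodEvent (H S : Matrix (Fin p) (Fin p) ℝ) (lam : Fin p → ℝ) (M B r : ℝ) : Prop where
  entry : ∀ k l, |H k l - S k l| ≤ M * r
  noise : ∀ j k, |(H *ᵥ popContrast S j) k - (S *ᵥ popContrast S j) k| ≤ M * r
  cone : (∀ j k, k ≠ j → |(H *ᵥ popContrast S j) k| ≤ lam j / 2) ∨ (p : ℝ) ≤ B

lemma tauSq_eq (x : Matrix (Fin n) (Fin p) ℝ) {lam : Fin p → ℝ}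
    {γ : ∀ j : Fin p, {k : Fin p // k ≠ j} → ℝ} {j : Fin p}
    (hγ : IsLassoSolution x (lam j) j (γ j)) :
    tauSq x lam γ j = (sampleCov x *ᵥ contrast j (γ j)) j := by
  rw [hγ.isContrastMin.mulVec_self (sampleCov_isSymm x), tauSq, residualMeanSq_eq,
    sum_abs_contrast]
  ring

/-- Constant in the `ℓ¹` error of the Lasso coefficients. -/
noncomputable def coefConst (c₂ A M B : ℝ) : ℝ := 4 * (M + A) / c₂ * B

/-- Constant in the error of the estimated residual variances. -/
noncomputable def tauConst (c₁ c₂ A M B : ℝ) : ℝ := M + √(16 * c₁ * (M + A) ^ 2 / c₂ * B)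

variable {x : Matrix (Fin n) (Fin p) ℝ} {S : Matrix (Fin p) (Fin p) ℝ} {lam : Fin p → ℝ}
  {γ : ∀ j : Fin p, {k : Fin p // k ≠ j} → ℝ} {c₁ c₂ A B M r : ℝ} {d : ℕ}

/-- The assumptions of the deterministic bounds: the population conditions, the size of the tuning
parameters, and the good event with a rate `r` that is small enough. -/
structure Regime (x : Matrix (Fin n) (Fin p) ℝ) (S : Matrix (Fin p) (Fin p) ℝ) (lam : Fin p → ℝ)
    (γ : ∀ j : Fin p, {k : Fin p // k ≠ j} → ℝ) (c₁ c₂ A B M r : ℝ) (d : ℕ) : Prop where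
  posDef : S.PosDef
  c₂_pos : 0 < c₂
  quadForm_ge : ∀ w : Fin p → ℝ, c₂ * ∑ k, w k ^ 2 ≤ w ⬝ᵥ S *ᵥ w
  diag_le : ∀ j, S j j ≤ c₁
  one_le_d : 1 ≤ d
  sparsity_le : rowSparsity S⁻¹ ≤ d
  M_nonneg : 0 ≤ M
  A_nonneg : 0 ≤ A
  le_B : 16 ≤ B
  r_nonneg : 0 ≤ r
  lam_pos : ∀ j, 0 < lam j
  lam_le : ∀ j, lam j ≤ A * r
  lasso : ∀ j, IsLassoSolution x (lam j) j (γ j)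
  good : GoodEvent (sampleCov x) S lam M B r
  curvature : M * r * (B * d) ≤ c₂ / 2
  entry_small : M * r ≤ c₁
  tau_small : tauConst c₁ c₂ A M B * (√d * r) ≤ c₂ / 2

lemma Regime.row_bounds (h : Regime x S lam γ c₁ c₂ A B M r d) (j : Fin p) :
    ∑ k, |contrast j (γ j) k - popContrast S j k| ≤ coefConst c₂ A M B * (d * r) ∧
    |tauSq x lam γ j - (S⁻¹ j j)⁻¹| ≤ tauConst c₁ c₂ A M B * (√d * r) := by
  have hH := sampleCov_isSymm x
  have hpos := sampleCov_quadForm_nonneg x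
  have hmin := (h.lasso j).isContrastMin
  have hc₀ := popContrast_self h.posDef j
  have hd : (1 : ℝ) ≤ d := by exact_mod_cast h.one_le_d
  have hB := h.le_B
  have hcone : (∑ k, |(contrast j (γ j) - popContrast S j) k|) ^ 2 ≤
      B * d * ∑ k, (contrast j (γ j) - popContrast S j) k ^ 2 := by
    rcases h.good.cone with hg | hg
    · refine (hmin.sq_sum_abs_le hH hpos (h.lam_pos j) hc₀ (hg j)
        ((ncard_popContrast_le j).trans h.sparsity_le)).trans ?_
      gcongr
    · refine (sq_sum_le_card_mul_sum_sq).trans ?_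
      simp_rw [sq_abs]
      rw [Finset.card_univ, Fintype.card_fin]
      gcongr
      nlinarith
  constructor
  · exact (hmin.sum_abs_sub_le hH hc₀ h.c₂_pos h.quadForm_ge h.M_nonneg (by linarith)
      (by linarith) h.r_nonneg (h.lam_pos j).le (h.lam_le j) h.good.entry
      (fun k hk => by simpa [mulVec_popContrast_ne h.posDef hk] using h.good.noise j k)
      hcone h.curvature).1
  · rw [tauSq_eq x (h.lasso j), ← mulVec_popContrast_self h.posDef]
    exact hmin.abs_mulVec_sub_le hH hpos hc₀ h.c₂_pos h.quadForm_ge (h.diag_le j) h.M_nonneg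
      h.A_nonneg (by linarith) hd h.r_nonneg (h.lam_pos j).le (h.lam_le j) h.good.entry
      (h.good.noise j) (fun k hk => mulVec_popContrast_ne h.posDef hk) hcone h.curvature
      h.entry_small

lemma precisionEstimator_apply (j k : Fin p) :
    precisionEstimator x lam γ j k = (tauSq x lam γ j)⁻¹ * contrast j (γ j) k := by
  rw [precisionEstimator, diagonal_mul, coefMatrix_apply]

lemma abs_inv_sub_inv_le {a b c ε : ℝ} (hc : 0 < c) (ha : c / 2 ≤ a) (hb : c ≤ b)
    (h : |a - b| ≤ ε) : |a⁻¹ - b⁻¹| ≤ 2 / c ^ 2 * ε := by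
  have ha' : 0 < a := by linarith
  have hb' : 0 < b := by linarith
  rw [inv_sub_inv ha'.ne' hb'.ne', abs_div, abs_of_pos (mul_pos ha' hb'), abs_sub_comm,
    div_le_iff₀ (mul_pos ha' hb')]
  have hab : c ^ 2 / 2 ≤ a * b := by nlinarith
  have hε : 0 ≤ ε := (abs_nonneg _).trans h
  calc |a - b| ≤ ε := h
    _ = 2 / c ^ 2 * ε * (c ^ 2 / 2) := by field_simp
    _ ≤ _ := by gcongr

lemma Regime.half_le_tauSq (h : Regime x S lam γ c₁ c₂ A B M r d) (j : Fin p) :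
    c₂ / 2 ≤ tauSq x lam γ j := by
  linarith [(abs_le.mp (h.row_bounds j).2).1, h.tau_small,
    le_inv_diag_inv h.posDef h.c₂_pos h.quadForm_ge j]

lemma Regime.abs_inv_tauSq_sub_le (h : Regime x S lam γ c₁ c₂ A B M r d) (j : Fin p) :
    |(tauSq x lam γ j)⁻¹ - S⁻¹ j j| ≤ 2 / c₂ ^ 2 * tauConst c₁ c₂ A M B * (√d * r) := by
  have hinv := abs_inv_sub_inv_le h.c₂_pos (h.half_le_tauSq j)
    (le_inv_diag_inv h.posDef h.c₂_pos h.quadForm_ge j) (h.row_bounds j).2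
  rwa [inv_inv, ← mul_assoc] at hinv

lemma Regime.maxDiag_le (h : Regime x S lam γ c₁ c₂ A B M r d) :
    maxDiag (precisionEstimator x lam γ - S⁻¹) ≤
    2 / c₂ ^ 2 * tauConst c₁ c₂ A M B * (√d * r) := by
  have hc₂ := h.c₂_pos
  have hr := h.r_nonneg
  have hτ : 0 ≤ tauConst c₁ c₂ A M B := add_nonneg h.M_nonneg (Real.sqrt_nonneg _)
  refine Real.iSup_le (fun j => ?_) (by positivity)
  rw [Matrix.sub_apply, precisionEstimator_apply, contrast_self, mul_one]
  exact h.abs_inv_tauSq_sub_le j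

lemma Regime.maxRowL1_le (h : Regime x S lam γ c₁ c₂ A B M r d) :
    maxRowL1 (precisionEstimator x lam γ - S⁻¹) ≤
    (2 / c₂ * coefConst c₂ A M B +
      2 / c₂ ^ 2 * tauConst c₁ c₂ A M B * √(2 * c₁ / c₂)) * (d * r) := by
  have hc₂ := h.c₂_pos
  have hr := h.r_nonneg
  have hM := h.M_nonneg
  have hA := h.A_nonneg
  have hτ : 0 ≤ tauConst c₁ c₂ A M B := add_nonneg h.M_nonneg (Real.sqrt_nonneg _)
  have hB : 0 ≤ B := by linarith [h.le_B]
  have hK : 0 ≤ coefConst c₂ A M B := by unfold coefConst; positivity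
  refine Real.iSup_le (fun j => ?_) (by positivity)
  have hτj := h.half_le_tauSq j
  have hτpos : 0 < tauSq x lam γ j := by linarith
  have hinv := h.abs_inv_tauSq_sub_le j
  have hl1 := (h.row_bounds j).1
  have hpop := sum_abs_popContrast_le h.posDef h.c₂_pos h.quadForm_ge (h.diag_le j) h.one_le_d
      h.sparsity_le
  have hτinv : (tauSq x lam γ j)⁻¹ ≤ 2 / c₂ := by
    rw [← inv_div]; exact inv_anti₀ (by positivity) hτj
  have hΓ : 0 < S⁻¹ j j := h.posDef.inv.diag_pos
  have hterm : ∀ k, |(precisionEstimator x lam γ - S⁻¹) j k| ≤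
      (tauSq x lam γ j)⁻¹ * |contrast j (γ j) k - popContrast S j k| +
        |(tauSq x lam γ j)⁻¹ - S⁻¹ j j| * |popContrast S j k| := by
    intro k
    have e : (precisionEstimator x lam γ - S⁻¹) j k =
        (tauSq x lam γ j)⁻¹ * (contrast j (γ j) k - popContrast S j k) +
        ((tauSq x lam γ j)⁻¹ - S⁻¹ j j) * popContrast S j k := by
      have : S⁻¹ j k = S⁻¹ j j * popContrast S j k := by
        simp [popContrast, hΓ.ne']
      rw [Matrix.sub_apply, precisionEstimator_apply, this]
      ring
    rw [e]
    refine (abs_add_le _ _).trans ?_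
    rw [abs_mul, abs_mul, abs_of_pos (inv_pos.mpr hτpos)]
  calc ∑ k, |(precisionEstimator x lam γ - S⁻¹) j k|
      ≤ (tauSq x lam γ j)⁻¹ * ∑ k, |contrast j (γ j) k - popContrast S j k| +
        |(tauSq x lam γ j)⁻¹ - S⁻¹ j j| * ∑ k, |popContrast S j k| := by
        rw [Finset.mul_sum, Finset.mul_sum, ← Finset.sum_add_distrib]
        exact Finset.sum_le_sum fun k _ => hterm k
    _ ≤ 2 / c₂ * (coefConst c₂ A M B * (d * r)) +
        2 / c₂ ^ 2 * tauConst c₁ c₂ A M B * (√d * r) * (√(2 * c₁ / c₂) * √d) := by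
        gcongr
    _ = _ := by
        have : √(d : ℝ) * √d = d := Real.mul_self_sqrt (Nat.cast_nonneg d)
        linear_combination (2 / c₂ ^ 2 * tauConst c₁ c₂ A M B * r * √(2 * c₁ / c₂)) * this

lemma Regime.maxEntry_le (h : Regime x S lam γ c₁ c₂ A B M r d) (hsmalld : √d * r ≤ 1) :
    maxEntry (precisionEstimator x lam γ * sampleCov x * (precisionEstimator x lam γ)ᵀ -
      (precisionEstimator x lam γ)ᵀ) ≤
    2 / c₂ * A * (2 / c₂ * (√(2 * c₁ / c₂) + coefConst c₂ A M B)) * (√d * r) := by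
  have hc₂ := h.c₂_pos
  have hr := h.r_nonneg
  have hM := h.M_nonneg
  have hA := h.A_nonneg
  have hB : 0 ≤ B := by linarith [h.le_B]
  have hK : 0 ≤ coefConst c₂ A M B := by unfold coefConst; positivity
  refine Real.iSup_le (fun i => Real.iSup_le (fun j => ?_) (by positivity)) (by positivity)
  have hτ : ∀ j, 0 < tauSq x lam γ j ∧ (tauSq x lam γ j)⁻¹ ≤ 2 / c₂ := by
    intro j
    have hτj := h.half_le_tauSq j
    exact ⟨by linarith, by rw [← inv_div]; exact inv_anti₀ (by positivity) hτj⟩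
  set G := precisionEstimator x lam γ with hG
  have hGH : ∀ k, (G * sampleCov x) i k =
      (tauSq x lam γ i)⁻¹ * (sampleCov x *ᵥ contrast i (γ i)) k := by
    intro k
    rw [← congrFun (vecMul_transpose (sampleCov x) (contrast i (γ i))) k, sampleCov_isSymm,
      Matrix.mul_apply, vecMul, dotProduct, Finset.mul_sum]
    refine Finset.sum_congr rfl fun l _ => ?_
    rw [hG, precisionEstimator_apply]
    ring
  have hdiff : ∀ k, |(G * sampleCov x - 1) i k| ≤ 2 / c₂ * A * r := by
    intro k
    rw [Matrix.sub_apply, hGH]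
    by_cases hk : k = i
    · subst hk
      rw [← tauSq_eq x (h.lasso k), inv_mul_cancel₀ (hτ k).1.ne', Matrix.one_apply_eq, sub_self,
        abs_zero]
      positivity
    · rw [Matrix.one_apply_ne (Ne.symm hk), sub_zero, abs_mul,
        abs_of_pos (inv_pos.mpr (hτ i).1), mul_assoc]
      exact mul_le_mul (hτ i).2 (((h.lasso i).isContrastMin.abs_mulVec_le (sampleCov_isSymm x)
        (h.lam_pos i).le hk).trans (h.lam_le i)) (abs_nonneg _) (by positivity)
  have hrow : ∑ k, |G j k| ≤ 2 / c₂ * (√(2 * c₁ / c₂) + coefConst c₂ A M B) * √d := by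
    have hl1 := (h.row_bounds j).1
    have hpop := sum_abs_popContrast_le h.posDef h.c₂_pos h.quadForm_ge (h.diag_le j) h.one_le_d
      h.sparsity_le
    have hdr : (d : ℝ) * r ≤ √d := by
      calc (d : ℝ) * r = √d * (√d * r) := by
            rw [← mul_assoc, Real.mul_self_sqrt (Nat.cast_nonneg d)]
        _ ≤ √d * 1 := by gcongr
        _ = √d := mul_one _
    have hc : ∑ k, |contrast j (γ j) k| ≤ (√(2 * c₁ / c₂) + coefConst c₂ A M B) * √d := by
      calc ∑ k, |contrast j (γ j) k|
          ≤ ∑ k, (|popContrast S j k| + |contrast j (γ j) k - popContrast S j k|) :=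
            Finset.sum_le_sum fun k _ => by
              simpa using abs_add_le (popContrast S j k) (contrast j (γ j) k - popContrast S j k)
        _ ≤ √(2 * c₁ / c₂) * √d + coefConst c₂ A M B * (d * r) := by
            rw [Finset.sum_add_distrib]; exact add_le_add hpop hl1
        _ ≤ √(2 * c₁ / c₂) * √d + coefConst c₂ A M B * √d := by gcongr
        _ = _ := by ring
    calc ∑ k, |G j k| = (tauSq x lam γ j)⁻¹ * ∑ k, |contrast j (γ j) k| := by
          rw [Finset.mul_sum]
          refine Finset.sum_congr rfl fun k _ => ?_
          rw [hG, precisionEstimator_apply, abs_mul, abs_of_pos (inv_pos.mpr (hτ j).1)]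
      _ ≤ 2 / c₂ * ((√(2 * c₁ / c₂) + coefConst c₂ A M B) * √d) :=
          mul_le_mul (hτ j).2 hc (Finset.sum_nonneg fun _ _ => abs_nonneg _) (by positivity)
      _ = _ := by ring
  have hent : (G * sampleCov x * Gᵀ - Gᵀ) i j = G j ⬝ᵥ fun k => (G * sampleCov x - 1) i k := by
    have : G * sampleCov x * Gᵀ - Gᵀ = (G * sampleCov x - 1) * Gᵀ := by
      rw [Matrix.sub_mul, Matrix.one_mul]
    rw [this, Matrix.mul_apply, dotProduct]
    exact Finset.sum_congr rfl fun k _ => by rw [Matrix.transpose_apply, mul_comm]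
  rw [hent]
  calc _ ≤ 2 / c₂ * A * r * ∑ k, |G j k| := abs_dotProduct_le fun k _ => hdiff k
    _ ≤ 2 / c₂ * A * r * (2 / c₂ * (√(2 * c₁ / c₂) + coefConst c₂ A M B) * √d) := by gcongr
    _ = _ := by ring

end Estimator

/-! ### Probability of the good event -/

section Probability

variable {n p : ℕ} {Ω : Type*} [MeasurableSpace Ω] {P : Measure Ω}
  {X : Fin n → Ω → EuclideanSpace ℝ (Fin p)} {θ : EuclideanSpace ℝ (Fin p)}
  {S : Matrix (Fin p) (Fin p) ℝ} {c r : ℝ}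

lemma measureReal_exists_bilin_le (hn : 0 < n) (hp : 2 ≤ p) (hS : S.PosSemidef)
    (hX : ∀ i, HasLaw (X i) (multivariateGaussian θ S) P) (hind : iIndepFun X P)
    {U W : Fin p → Fin p → Fin p → ℝ} (hc : 0 < c) (hU : ∀ j k, U j k ⬝ᵥ S *ᵥ U j k ≤ c)
    (hW : ∀ j k, W j k ⬝ᵥ S *ᵥ W j k ≤ c) (hr : 0 < r) (hnr : n * r ^ 2 = Real.log p) {m : ℕ}
    (hm : 0 < m) (hsmall : √(128 * m) * c * r ≤ 4 * c) :
    P.real {ω | ∃ j k, √(128 * m) * c * r <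
      |U j k ⬝ᵥ sampleCov (Matrix.of fun i j => X i ω j) *ᵥ W j k - U j k ⬝ᵥ S *ᵥ W j k|} ≤
      8 * (p : ℝ) ^ 2 / p ^ m := by
  have : IsProbabilityMeasure P := hind.isProbabilityMeasure
  have hp0 : (0 : ℝ) < p := by positivity
  have hexp : Real.exp (-(n * (√(128 * m) * c * r) ^ 2 / (128 * c ^ 2))) = ((p : ℝ) ^ m)⁻¹ := by
    rw [Real.exp_neg, mul_pow, mul_pow, Real.sq_sqrt (by positivity),
      show n * (128 * m * c ^ 2 * r ^ 2) / (128 * c ^ 2) = m * (n * r ^ 2) by field_simp, hnr,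
      Real.exp_nat_mul, Real.exp_log hp0]
  simp only [Set.ofPred_exists]
  calc _ ≤ ∑ j, ∑ k, P.real {ω | √(128 * m) * c * r <
      |U j k ⬝ᵥ sampleCov (Matrix.of fun i j => X i ω j) *ᵥ W j k - U j k ⬝ᵥ S *ᵥ W j k|} :=
        (measureReal_iUnion_fintype_le _).trans
          (Finset.sum_le_sum fun j _ => measureReal_iUnion_fintype_le _)
    _ ≤ ∑ _j : Fin p, ∑ _k : Fin p, 8 * ((p : ℝ) ^ m)⁻¹ := by
        refine Finset.sum_le_sum fun j _ => Finset.sum_le_sum fun k _ => ?_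
        rw [← hexp]
        exact measureReal_sampleCov_bilin_le hn hS hX hind hc (hU j k) (hW j k) (by positivity)
          hsmall
    _ = _ := by
        simp
        field_simp

lemma measureReal_not_goodEvent_le (hn : 0 < n) (hp : 2 ≤ p) (hS : S.PosDef)
    (hX : ∀ i, HasLaw (X i) (multivariateGaussian θ S) P) (hind : iIndepFun X P)
    (hc : 0 < c) (hdiag : ∀ j, S j j ≤ c) {lam : Fin p → ℝ} (hr : 0 < r)
    (hnr : n * r ^ 2 = Real.log p) (hlam : ∀ j, 2 * (√(128 * (3 : ℕ)) * c) * r ≤ lam j) {m : ℕ}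
    (hm : 0 < m) (hsmall : √(128 * m) * c * r ≤ 4 * c)
    (hsmall' : √(128 * (3 : ℕ)) * c * r ≤ 4 * c) {B : ℝ} (hB : 0 < B) :
    P.real {ω | ¬ GoodEvent (sampleCov (Matrix.of fun i j => X i ω j)) S lam
      (√(128 * m) * c) B r} ≤ 16 * (p : ℝ) ^ 2 / p ^ m + 8 / B := by
  have : IsProbabilityMeasure P := hind.isProbabilityMeasure
  have hp0 : (0 : ℝ) < p := by positivity
  set H : Ω → Matrix (Fin p) (Fin p) ℝ := fun ω => sampleCov (Matrix.of fun i j => X i ω j) with hH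
  have hsingle : ∀ k : Fin p, Pi.single k 1 ⬝ᵥ S *ᵥ Pi.single k 1 ≤ c := fun k => by
    simpa using hdiag k
  have hpop : ∀ j, popContrast S j ⬝ᵥ S *ᵥ popContrast S j ≤ c := fun j => by
    rw [quadForm_popContrast hS]
    exact (inv_diag_inv_le hS j).trans (hdiag j)
  have h1 := measureReal_exists_bilin_le hn hp hS.posSemidef hX hind
    (U := fun j _ => Pi.single j 1) (W := fun _ k => Pi.single k 1) hc (fun j _ => hsingle j)
    (fun _ k => hsingle k) hr hnr hm hsmall
  have h2 := measureReal_exists_bilin_le hn hp hS.posSemidef hX hind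
    (U := fun _ k => Pi.single k 1) (W := fun j _ => popContrast S j) hc (fun _ k => hsingle k)
    (fun j _ => hpop j) hr hnr hm hsmall
  have h3 := measureReal_exists_bilin_le hn hp hS.posSemidef hX hind
    (U := fun _ k => Pi.single k 1) (W := fun j _ => popContrast S j) hc (fun _ k => hsingle k)
    (fun j _ => hpop j) hr hnr (m := 3) (by norm_num) hsmall'
  simp only [mulVec_single_one, single_one_dotProduct, col_apply] at h1 h2 h3
  change P.real {ω | ∃ j k, _ < |H ω j k - _|} ≤ _ at h1
  change P.real {ω | ∃ j k, _ < |(H ω *ᵥ _) k - _|} ≤ _ at h2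
  change P.real {ω | ∃ j k, _ < |(H ω *ᵥ _) k - _|} ≤ _ at h3
  rw [show 16 * (p : ℝ) ^ 2 / p ^ m = 8 * (p : ℝ) ^ 2 / p ^ m + 8 * (p : ℝ) ^ 2 / p ^ m by ring]
  by_cases hpB : (p : ℝ) ≤ B
  · calc _ ≤ _ := measureReal_mono (s₂ := {ω | ∃ j k, √(128 * m) * c * r < |H ω j k - S j k|} ∪
          {ω | ∃ j k, √(128 * m) * c * r <
            |(H ω *ᵥ popContrast S j) k - (S *ᵥ popContrast S j) k|}) ?_
      _ ≤ _ := measureReal_union_le _ _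
      _ ≤ _ := add_le_add h1 h2
      _ ≤ _ := le_add_of_nonneg_right (by positivity)
    intro ω hω
    by_contra hcon
    simp only [Set.mem_union, Set.mem_ofPred_eq, not_or, not_exists, not_lt] at hcon hω
    exact hω ⟨hcon.1, hcon.2, Or.inr hpB⟩
  · have h3' : 8 * (p : ℝ) ^ 2 / p ^ 3 ≤ 8 / B := by
      rw [show 8 * (p : ℝ) ^ 2 / p ^ 3 = 8 / p by field_simp]
      exact div_le_div_of_nonneg_left (by norm_num) hB (not_le.mp hpB).le
    calc _ ≤ _ := measureReal_mono (s₂ := ({ω | ∃ j k, √(128 * m) * c * r < |H ω j k - S j k|} ∪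
          {ω | ∃ j k, √(128 * m) * c * r <
            |(H ω *ᵥ popContrast S j) k - (S *ᵥ popContrast S j) k|}) ∪
          {ω | ∃ j k, √(128 * (3 : ℕ)) * c * r <
            |(H ω *ᵥ popContrast S j) k - (S *ᵥ popContrast S j) k|}) ?_
      _ ≤ _ := measureReal_union_le _ _
      _ ≤ _ := add_le_add ((measureReal_union_le _ _).trans (add_le_add h1 h2)) (h3.trans h3')
    intro ω hω
    by_contra hcon
    simp only [Set.mem_union, Set.mem_ofPred_eq, not_or, not_exists, not_lt] at hcon hω
    refine hω ⟨hcon.1.1, hcon.1.2, Or.inl fun j k hk => ?_⟩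
    have := hcon.2 j k
    rw [mulVec_popContrast_ne hS hk, sub_zero] at this
    linarith [hlam j]

lemma exists_pow_bound {ε : ℝ} (hε : 0 < ε) :
    ∃ m : ℕ, 0 < m ∧ ∀ p : ℕ, 2 ≤ p → 16 * (p : ℝ) ^ 2 / p ^ m ≤ ε := by
  obtain ⟨k, hk⟩ := exists_pow_lt_of_lt_one (div_pos hε (by norm_num : (0 : ℝ) < 16))
    (by norm_num : (1 / 2 : ℝ) < 1)
  refine ⟨k + 2, by omega, fun p hp => ?_⟩
  have hp0 : (0 : ℝ) < p := by positivity
  have hp2 : (2 : ℝ) ≤ p := by exact_mod_cast hp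
  calc 16 * (p : ℝ) ^ 2 / p ^ (k + 2) = 16 * (1 / p) ^ k := by
        rw [pow_add, one_div, inv_pow]; field_simp
    _ ≤ 16 * (1 / 2) ^ k := by gcongr
    _ ≤ ε := by linarith

end Probability

lemma maxDiag_nonneg {p : ℕ} (A : Matrix (Fin p) (Fin p) ℝ) : 0 ≤ maxDiag A :=
  Real.iSup_nonneg fun _ => abs_nonneg _

lemma maxRowL1_nonneg {p : ℕ} (A : Matrix (Fin p) (Fin p) ℝ) : 0 ≤ maxRowL1 A :=
  Real.iSup_nonneg fun _ => Finset.sum_nonneg fun _ _ => abs_nonneg _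

lemma maxEntry_nonneg {p : ℕ} (A : Matrix (Fin p) (Fin p) ℝ) : 0 ≤ maxEntry A :=
  Real.iSup_nonneg fun _ => Real.iSup_nonneg fun _ => abs_nonneg _

lemma IsBigOP.of_forall_eventually_subset {Ω : ℕ → Type*} [∀ n, MeasurableSpace (Ω n)]
    {P : ∀ n, Measure (Ω n)} {Z : ∀ n, Ω n → ℝ} {r : ℕ → ℝ} (hr : ∀ n, 0 ≤ r n)
    (h : ∀ ε : ℝ, 0 < ε → ∃ (K : ℝ) (E : ∀ n, Set (Ω n)), ∀ᶠ n in atTop,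
      P n (E n) ≤ ENNReal.ofReal ε ∧ ∀ ω ∉ E n, |Z n ω| ≤ K * r n) : IsBigOP P Z r := by
  intro ε hε
  obtain ⟨K, E, hE⟩ := h ε hε
  refine ⟨max K 1, by positivity, hE.mono fun n hn => (measure_mono fun ω hω => ?_).trans hn.1⟩
  by_contra hcon
  have h1 := hn.2 ω hcon
  have h2 := mul_le_mul_of_nonneg_right (le_max_left K 1) (hr n)
  simp only [Set.mem_ofPred_eq] at hω
  linarith

end NodewiseLasso

open NodewiseLasso in
theorem mainTheorem6 (c₁ c₂ : ℝ) (hc₁ : 0 < c₁) (hc₂ : 0 < c₂) :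
    -- a lower threshold for the tuning constants, depending on `c₁, c₂` only
    ∃ A₀ : ℝ, 0 < A₀ ∧
    ∀ (A₁ : ℝ) (p : ℕ → ℕ) (_hp : ∀ n, 2 ≤ p n)
      -- i.i.d. samples `X n 0, …, X n (n - 1)` from `N_p(θ, Σ)`
      (Ω : ℕ → Type*) [∀ n, MeasurableSpace (Ω n)]
      (P : ∀ n, Measure (Ω n)) [∀ n, IsProbabilityMeasure (P n)]
      (θ : ∀ n, EuclideanSpace ℝ (Fin (p n)))
      (S : ∀ n, Matrix (Fin (p n)) (Fin (p n)) ℝ) (hS : ∀ n, (S n).PosSemidef)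
      (X : ∀ n, Fin n → Ω n → EuclideanSpace ℝ (Fin (p n)))
      (_hlaw : ∀ n i, HasLaw (X n i) (multivariateGaussian (θ n) (S n)) (P n))
      (_hindep : ∀ n, iIndepFun (X n) (P n))
      -- bounded variances, and smallest eigenvalue bounded away from zero
      (_hdiag : ∀ n j, S n j j < c₁)
      (_heig : ∀ n j, c₂ < (hS n).isHermitian.eigenvalues j)
      -- the sparsity level `d = max(1, ·)` of the precision matrix, with `d² log p / n → 0`
      (d : ℕ → ℕ) (_hd : ∀ n, d n = max 1 (NodewiseLasso.rowSparsity (S n)⁻¹))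
      (_hrate : Tendsto (fun n : ℕ => (d n : ℝ) ^ 2 * Real.log (p n) / n) atTop (𝓝 0))
      -- tuning parameters of exact order `√(log p / n)`
      (lam : ∀ n, Fin (p n) → ℝ)
      (_hlam : ∀ n j, A₀ * √(Real.log (p n) / n) ≤ lam n j ∧
        lam n j ≤ A₁ * √(Real.log (p n) / n))
      -- the data matrix, and any choice of solutions of the nodewise Lasso problems
      (x : ∀ n, Ω n → Matrix (Fin n) (Fin (p n)) ℝ)
      (_hx : ∀ n ω, x n ω = Matrix.of fun i j => X n i ω j)
      (γ : ∀ n, Ω n → ∀ j : Fin (p n), {k : Fin (p n) // k ≠ j} → ℝ)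
      (_hγ : ∀ n ω j, NodewiseLasso.IsLassoSolution (x n ω) (lam n j) j (γ n ω j))
      (G : ∀ n, Ω n → Matrix (Fin (p n)) (Fin (p n)) ℝ)
      (_hG : ∀ n ω, G n ω = NodewiseLasso.precisionEstimator (x n ω) (lam n) (γ n ω)),
      NodewiseLasso.IsBigOP P (fun n ω => NodewiseLasso.maxDiag (G n ω - (S n)⁻¹))
        (fun n => √(d n * Real.log (p n) / n)) ∧
      NodewiseLasso.IsBigOP P (fun n ω => NodewiseLasso.maxRowL1 (G n ω - (S n)⁻¹))
        (fun n => d n * √(Real.log (p n) / n)) ∧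
      NodewiseLasso.IsBigOP P
        (fun n ω => NodewiseLasso.maxEntry
          (G n ω * NodewiseLasso.sampleCov (x n ω) * (G n ω).transpose - (G n ω).transpose))
        (fun n => √(d n * Real.log (p n) / n)) := by
  refine ⟨2 * (√(128 * (3 : ℕ)) * c₁), by positivity, ?_⟩
  intro A₁ p hp Ω _ P _ θ S hS X hlaw hindep hdiag heig d hd hrate lam hlam x hx γ hγ G hG
  obtain rfl : x = fun n ω => Matrix.of fun i j => X n i ω j := by ext1 n; ext1 ω; exact hx n ω
  obtain rfl : G = fun n ω => precisionEstimator _ (lam n) (γ n ω) := by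
    ext1 n; ext1 ω; exact hG n ω
  set r : ℕ → ℝ := fun n => √(Real.log (p n) / n) with hr
  have hlogpos : ∀ n, 0 < Real.log (p n) := fun n =>
    Real.log_pos (by exact_mod_cast (hp n))
  have hr0 : ∀ n, 0 ≤ r n := fun n => Real.sqrt_nonneg _
  have hrpos : ∀ n, 0 < n → 0 < r n := fun n hn =>
    Real.sqrt_pos.mpr (div_pos (hlogpos n) (by exact_mod_cast hn))
  have hnr : ∀ n : ℕ, 0 < n → n * r n ^ 2 = Real.log (p n) := fun n hn => by
    have : (0 : ℝ) < n := by exact_mod_cast hn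
    rw [hr, Real.sq_sqrt (div_nonneg (hlogpos n).le this.le)]
    field_simp
  have hA₁ : 0 < A₁ := by
    have h := hlam 1 ⟨0, by have := hp 1; omega⟩
    have h1 := hrpos 1 one_pos
    have h2 := lt_of_lt_of_le (by positivity) (h.1.trans h.2)
    exact pos_of_mul_pos_left h2 h1.le
  have hd1 : ∀ n, 1 ≤ d n := fun n => by rw [hd]; exact le_max_left _ _
  have hdS : ∀ n, rowSparsity (S n)⁻¹ ≤ d n := fun n => by rw [hd n]; exact le_max_right _ _
  have hlow := fun n => le_quadForm_of_lt_eigenvalues (hS n).isHermitian (heig n)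
  have hSd := fun n => posDef_of_le_quadForm (hS n).isHermitian hc₂ (hlow n)
  have hdr : Tendsto (fun n => d n * r n) atTop (𝓝 0) := by
    have h := hrate.sqrt
    rw [Real.sqrt_zero] at h
    refine h.congr fun n => ?_
    rw [mul_div_assoc, Real.sqrt_mul (by positivity), Real.sqrt_sq (by positivity)]
  have hsqrtd : ∀ n, √(d n : ℝ) * r n ≤ d n * r n := fun n => by
    have : (1 : ℝ) ≤ d n := by exact_mod_cast hd1 n
    refine mul_le_mul_of_nonneg_right ?_ (hr0 n)
    exact Real.sqrt_le_left (by positivity) |>.mpr (by nlinarith)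
  have hrd : ∀ n, r n ≤ d n * r n := fun n =>
    le_mul_of_one_le_left (hr0 n) (by exact_mod_cast hd1 n)
  have hsmall : ∀ K δ : ℝ, 0 < δ → ∀ᶠ n in atTop, K * (d n * r n) ≤ δ := fun K δ hδ => by
    have h := hdr.const_mul K
    rw [mul_zero] at h
    exact h.eventually_le_const hδ
  have hrate_eq : ∀ n, √(d n * Real.log (p n) / n) = √(d n) * r n := fun n => by
    rw [mul_div_assoc, Real.sqrt_mul (by positivity)]
  have main : ∀ ε : ℝ, 0 < ε → ∃ (M B : ℝ) (E : ∀ n, Set (Ω n)),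
      ∀ᶠ n in atTop, P n (E n) ≤ ENNReal.ofReal ε ∧ √(d n) * r n ≤ 1 ∧
        ∀ ω ∉ E n, Regime (Matrix.of fun i j => X n i ω j) (S n) (lam n) (γ n ω)
          c₁ c₂ A₁ B M (r n) (d n) := by
    intro ε hε
    obtain ⟨m, hm, hmp⟩ := exists_pow_bound (half_pos hε)
    set M : ℝ := √(128 * m) * c₁ with hM
    set B : ℝ := max 16 (16 / ε) with hB
    have hM0 : 0 ≤ M := by positivity
    have hB16 : 16 ≤ B := le_max_left _ _
    have hBpos : 0 < B := by linarith
    have hτ : 0 ≤ tauConst c₁ c₂ A₁ M B := add_nonneg hM0 (Real.sqrt_nonneg _)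
    refine ⟨M, B, fun n => {ω | ¬ GoodEvent (sampleCov (Matrix.of fun i j => X n i ω j)) (S n)
      (lam n) M B (r n)}, ?_⟩
    filter_upwards [eventually_gt_atTop 0, hsmall (M * B) (c₂ / 2) (by positivity),
      hsmall M c₁ hc₁, hsmall (√(128 * (3 : ℕ)) * c₁) c₁ hc₁,
      hsmall (tauConst c₁ c₂ A₁ M B) (c₂ / 2) (by positivity), hsmall 1 1 one_pos]
      with n hn h1 h2 h3 h4 h5
    have hMr : M * r n ≤ c₁ := (mul_le_mul_of_nonneg_left (hrd n) hM0).trans h2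
    have h3r : √(128 * (3 : ℕ)) * c₁ * r n ≤ c₁ :=
      (mul_le_mul_of_nonneg_left (hrd n) (by positivity)).trans h3
    refine ⟨?_, by linarith [hsqrtd n], fun ω hω => ?_⟩
    · have h := measureReal_not_goodEvent_le hn (hp n) (hSd n) (hlaw n) (hindep n) hc₁
        (fun j => (hdiag n j).le) (hrpos n hn) (hnr n hn) (fun j => (hlam n j).1) hm
        (by linarith) (by linarith) hBpos
      rw [← ofReal_measureReal]
      refine ENNReal.ofReal_le_ofReal (h.trans ?_)
      have hB' : 8 / B ≤ ε / 2 := by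
        rw [div_le_iff₀ hBpos]
        have : 16 / ε ≤ B := le_max_right _ _
        rw [div_le_iff₀ hε] at this
        linarith
      linarith [hmp (p n) (hp n)]
    · exact
        { posDef := hSd n
          c₂_pos := hc₂
          quadForm_ge := hlow n
          diag_le := fun j => (hdiag n j).le
          one_le_d := hd1 n
          sparsity_le := hdS n
          M_nonneg := hM0
          A_nonneg := hA₁.le
          le_B := hB16
          r_nonneg := hr0 n
          lam_pos := fun j => lt_of_lt_of_le (by have := hrpos n hn; positivity) (hlam n j).1
          lam_le := fun j => (hlam n j).2
          lasso := hγ n ω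
          good := by simpa using hω
          curvature := by linarith
          entry_small := hMr
          tau_small := (mul_le_mul_of_nonneg_left (hsqrtd n) hτ).trans h4 }
  refine ⟨?_, ?_, ?_⟩
  · refine IsBigOP.of_forall_eventually_subset (fun n => Real.sqrt_nonneg _) fun ε hε => ?_
    obtain ⟨M, B, E, hE⟩ := main ε hε
    refine ⟨2 / c₂ ^ 2 * tauConst c₁ c₂ A₁ M B, E, hE.mono fun n hn => ⟨hn.1, fun ω hω => ?_⟩⟩
    rw [hrate_eq, abs_of_nonneg (maxDiag_nonneg _)]
    exact (hn.2.2 ω hω).maxDiag_le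
  · refine IsBigOP.of_forall_eventually_subset (fun n => by positivity) fun ε hε => ?_
    obtain ⟨M, B, E, hE⟩ := main ε hε
    refine ⟨2 / c₂ * coefConst c₂ A₁ M B + 2 / c₂ ^ 2 * tauConst c₁ c₂ A₁ M B * √(2 * c₁ / c₂), E,
      hE.mono fun n hn => ⟨hn.1, fun ω hω => ?_⟩⟩
    rw [abs_of_nonneg (maxRowL1_nonneg _)]
    exact (hn.2.2 ω hω).maxRowL1_le
  · refine IsBigOP.of_forall_eventually_subset (fun n => Real.sqrt_nonneg _) fun ε hε => ?_
    obtain ⟨M, B, E, hE⟩ := main ε hε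
    refine ⟨2 / c₂ * A₁ * (2 / c₂ * (√(2 * c₁ / c₂) + coefConst c₂ A₁ M B)), E,
      hE.mono fun n hn => ⟨hn.1, fun ω hω => ?_⟩⟩
    rw [hrate_eq, abs_of_nonneg (maxEntry_nonneg _)]
    exact (hn.2.2 ω hω).maxEntry_le hn.2.1
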